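/- Let $a\neq 0$ be a real number and let $F$ be a finite set of positive integers with $n_F$ elements. Let $\rho_a=\sum_{x=0}^{\infty}\frac{a^x}{x!}\delta_x$ be the (possibly signed) Charlier measure and put $$\rho_a^F=\prod_{f\in F}(x-f)\,\rho_a .$$ A sequence $(q_n)_{n\ge 0}$ of real polynomials is said to be orthogonal with respect to $\rho_a^F$ if $\deg q_n=n$, $\int q_nq_m\,d\rho_a^F=0$ for $n\ne m$, and $\int q_n^2\,d\rho_a^F\neq 0$ for all $n\ge 0$. Let $c_n^{b}(x)=\frac1{n!}\sum_{j=0}^n(-b)^{n-j}\binom nj\binom xj j!$ be the Charlier polynomials, let $$G=I(F)=\{1,2,\ldots,\max F\}\setminus\{\max F-f: f\in F\}=\{g_1<\cdots<g_m\}$$ (with $I(\emptyset)=\emptyset$), and let $$\Omega_G(n)=\det\left(c^{-a}_{g_l}(-n+j-1)\right)_{l,j=1}^m$$ (equal to $1$ if $m=0$). Then: 1. If $\Omega_G(n)\neq 0$ for all integers $n\ge 0$, then there is a sequence of polynomials orthogonal with respect to $\rho_a^F$. 2. (Conjecture A.) Whenever $(q_n)_{n\ge 0}$ is a sequence of polynomials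 orthogonal with respect to $\rho_a^F$ (in particular, under the hypothesis of 1), there are a difference operator $$D=\sum_{l=-r}^{r}h_l(x)\,\mathfrak s_l,\qquad \mathfrak s_l(p)(x)=p(x+l),$$ with real polynomial coefficients $h_l$, $h_{-r}\neq 0$, $h_r\ne 0$, where $$r=\sum_{f\in F}f-\frac{n_F(n_F-1)}{2}+1,$$ and real numbers $\lambda_n$ such that $D(q_n)=\lambda_n q_n$ for all $n\ge 0$. -/

import Mathlib

open Polynomial

namespace CharlierKrall

/-- Every polynomial is absolutely summable against the Charlier weight `a ^ x / x!`. -/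
theorem summable_charlier (a : ℝ) (p : ℝ[X]) :
    Summable fun x : ℕ => p.eval (x : ℝ) * (a ^ x / (x.factorial : ℝ)) := by
  have hexp : ∀ b : ℝ, Summable fun x : ℕ => b ^ x / (x.factorial : ℝ) :=
    Real.summable_pow_div_factorial
  have hmon : ∀ k : ℕ,
      Summable fun x : ℕ => (x : ℝ) ^ k * (a ^ x / (x.factorial : ℝ)) := by
    intro k
    refine Summable.of_norm_bounded
      (((hexp (Real.exp 1 * |a|)).mul_left (k.factorial : ℝ))) ?_
    intro x
    have h1 : (x : ℝ) ^ k / (k.factorial : ℝ) ≤ Real.exp x :=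
      Real.pow_div_factorial_le_exp (x : ℝ) (Nat.cast_nonneg x) k
    have hk : (0 : ℝ) < (k.factorial : ℝ) := by positivity
    have h2 : (x : ℝ) ^ k ≤ (k.factorial : ℝ) * Real.exp x := by
      rw [div_le_iff₀ hk] at h1
      linarith
    have h3 : Real.exp (x : ℝ) = Real.exp 1 ^ x := by
      rw [← Real.exp_nat_mul, mul_one]
    have h4 : ‖(x : ℝ) ^ k * (a ^ x / (x.factorial : ℝ))‖
        = (x : ℝ) ^ k * (|a| ^ x / (x.factorial : ℝ)) := by
      simp [abs_mul, abs_div, abs_pow]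
    rw [h4, mul_pow, ← h3, mul_div_assoc, ← mul_assoc]
    exact mul_le_mul_of_nonneg_right h2 (by positivity)
  induction p using Polynomial.induction_on' with
  | add p q hp hq =>
    refine (hp.add hq).congr ?_
    intro x
    simp [add_mul]
  | monomial k c =>
    refine ((hmon k).mul_left c).congr ?_
    intro x
    simp [mul_assoc]

/-- The Charlier measure `ρ_a = ∑_{x ≥ 0} (a ^ x / x!) δ_x` (signed when `a < 0`), as the
moment functional `p ↦ ∫ p dρ_a` on real polynomials. -/
noncomputable def charlierMeasure (a : ℝ) : ℝ[X] →ₗ[ℝ] ℝ where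
  toFun p := ∑' x : ℕ, p.eval (x : ℝ) * (a ^ x / (x.factorial : ℝ))
  map_add' p q := by
    rw [← (summable_charlier a p).tsum_add (summable_charlier a q)]
    simp [add_mul]
  map_smul' c p := by
    simp [mul_assoc, tsum_mul_left]

/-- The Christoffel transform `r μ` of a moment functional: `⟨r μ, p⟩ = ⟨μ, r p⟩`. -/
noncomputable def christoffel (r : ℝ[X]) (μ : ℝ[X] →ₗ[ℝ] ℝ) : ℝ[X] →ₗ[ℝ] ℝ :=
  μ.comp (LinearMap.mulLeft ℝ r)

/-- The measure `ρ_a^F = ∏_{f ∈ F} (x - f) ρ_a`. -/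
noncomputable def charlierChristoffel (a : ℝ) (F : Finset ℕ) : ℝ[X] →ₗ[ℝ] ℝ :=
  christoffel (∏ f ∈ F, (X - C (f : ℝ))) (charlierMeasure a)

/-- `(q_n)` is a sequence of orthogonal polynomials for the moment functional `μ`:
`deg q_n = n`, `⟨μ, q_n q_m⟩ = 0` for `n ≠ m`, and `⟨μ, q_n ^ 2⟩ ≠ 0`. -/
structure IsOrthogonalSequence (μ : ℝ[X] →ₗ[ℝ] ℝ) (q : ℕ → ℝ[X]) : Prop where
  degree_eq : ∀ n, (q n).degree = (n : WithBot ℕ)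
  orthogonal : ∀ n m, n ≠ m → μ (q n * q m) = 0
  norm_ne_zero : ∀ n, μ (q n ^ 2) ≠ 0

/-- The Charlier polynomial
`c_n^a (x) = (1 / n!) ∑_{j=0}^n (-a)^(n-j) (n choose j) (x choose j) j!`, where
`(x choose j) j! = x (x - 1) ⋯ (x - j + 1)` is the falling factorial. -/
noncomputable def charlier (a : ℝ) (n : ℕ) : ℝ[X] :=
  C (1 / (n.factorial : ℝ)) *
    ∑ j ∈ Finset.range (n + 1), C ((-a) ^ (n - j) * (n.choose j : ℝ)) * descPochhammer ℝ j

/-- The involution `I(F) = {1, …, max F} \ {max F - f : f ∈ F}` on finite sets of positive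
integers, with `I(∅) = ∅`. (As `f ≤ max F` the subtraction is the usual one.) -/
def involution (F : Finset ℕ) : Finset ℕ :=
  Finset.Icc 1 (F.sup id) \ F.image fun f => F.sup id - f

/-- The Casorati determinant `det (c_{g_l}^{-a} (-n + j - 1))_{l,j=1}^m` of the set
`G = {g_1 < ⋯ < g_m}`. The indices `l, j : Fin m` start at `0`, hence the `j + 1`. -/
noncomputable def casorati (a : ℝ) (G : Finset ℕ) (n : ℕ) : ℝ :=
  Matrix.det (Matrix.of fun l j : Fin G.card =>
    (charlier (-a) (G.orderEmbOfFin rfl l)).eval (-(n : ℝ) + ((j : ℕ) + 1 : ℝ) - 1))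

/-- `D` is a difference operator `∑_{l=s}^r h_l(x) 𝔰_l` of genre `(s, r)`: the `h_l` are
polynomials, `𝔰_l p (x) = p (x + l)`, and `h_s`, `h_r` do not vanish identically. -/
def IsDifferenceOperator (D : ℝ[X] →ₗ[ℝ] ℝ[X]) (s r : ℤ) : Prop :=
  s ≤ r ∧ ∃ h : ℤ → ℝ[X], h s ≠ 0 ∧ h r ≠ 0 ∧
    ∀ p : ℝ[X], D p = ∑ l ∈ Finset.Icc s r, h l * p.comp (X + C (l : ℝ))

/-- `r = ∑_{f ∈ F} f - n_F (n_F - 1) / 2 + 1`; the division of integers is exact. -/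
def krallOrder (F : Finset ℕ) : ℤ :=
  (∑ f ∈ F, (f : ℤ)) - (F.card : ℤ) * ((F.card : ℤ) - 1) / 2 + 1

end CharlierKrall

namespace CharlierKrall

/-! Put L = max F + 1 (L = 0 if F is empty) and G = I(F) = {g_i}. The numbers below L missing from F
are κ_i = L - 1 - g_i. Filling these gaps turns ∏ (x - f) into x(x - 1)⋯(x - L + 1), which merely
translates ρ_a by L, up to the factor a^L. Hence Σ_{j ≤ m} γ_j c_{n-j}(x - L) is orthogonal to every
multiple of ∏ (x - κ_i) of degree < n. By `charlierMeasure_puncturedProd`, orthogonality to the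
remaining polynomials of degree < n follows from the m relations Σ_j (-1)^j γ_j Y_i(n - j) = 0,
where Y_i(x) = c_{g_i}^{-a}(-x - 1) (`charlierChristoffel_comb_mul_eq_zero`). If Ω_G(n) ≠ 0 they can
be solved with γ_0 = 1, which gives claim 1. Conversely an orthogonal sequence forces Ω_G(n) ≠ 0
(`casoratiMatrix_det_ne_zero`), so in claim 2 each q_n is a multiple of such a combination.

The second order operator N with N c_k = k c_k and the backward difference ∇ give D = P(N) + Σ_i
M_i(N) ∇ Y_i(N), up to translation by L. Here ∇P is the Casorati determinant and M_i is a sum of its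
cofactors. P(N) multiplies the coefficient γ_j by P(n - j). By the relations and Cramer's rule the
other terms add γ_j (P(n) - P(n - j)), so the eigenvalue is P(n) (`krallOp_charlierComb`).

The order is deg P = Σ g_i - m(m - 1)/2 + 1. Antisymmetry lowers the degree of M_i
(`cofactorSum_natDegree`) so far that only P(N) contributes to the top terms of the two extreme
coefficients (`krallOp_hasSymbol`). Counting gaps rewrites this order in terms of F
(`krallOrder_eq`). -/

/-! ### Charlier polynomials: raising, lowering, duality. -/

@[simp] theorem charlier_zero (a : ℝ) : charlier a 0 = 1 := by
  simp [charlier]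

/-- The map p(x) ↦ x p(x - 1) sends each falling factorial to the next, and Pascal's rule recombines
the coefficients. -/
theorem charlier_succ (a : ℝ) (n : ℕ) :
    C ((n : ℝ) + 1) * charlier a (n + 1)
      = X * taylor (-1) (charlier a n) - C a * charlier a n := by
  set e : ℕ → ℝ[X] := fun n => ∑ j ∈ Finset.range (n + 1),
    C ((-a) ^ (n - j) * (n.choose j : ℝ)) * descPochhammer ℝ j with he
  have hd : ∀ j : ℕ, X * taylor (-1) (descPochhammer ℝ j) = descPochhammer ℝ (j + 1) := by
    intro j
    rw [descPochhammer_succ_left, taylor_apply]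
    simp [sub_eq_add_neg]
  have h1 : X * taylor (-1) (e n) = ∑ j ∈ Finset.range (n + 1),
      C ((-a) ^ (n - j) * (n.choose j : ℝ)) * descPochhammer ℝ (j + 1) := by
    simp only [he, map_sum, Finset.mul_sum, taylor_mul, taylor_C]
    refine Finset.sum_congr rfl fun j _ => ?_
    rw [← hd j]
    ring
  have h2 : -(C a * e n) = C ((-a) ^ (n + 1)) + ∑ j ∈ Finset.range (n + 1),
      C ((-a) ^ (n - j) * (n.choose (j + 1) : ℝ)) * descPochhammer ℝ (j + 1) := by
    simp only [he]
    rw [Finset.sum_range_succ', Finset.sum_range_succ _ n]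
    simp only [Nat.choose_succ_self, Nat.cast_zero, mul_zero, C_0, zero_mul, add_zero,
      descPochhammer_zero, Nat.choose_zero_right, Nat.cast_one, mul_one, Nat.sub_zero]
    rw [mul_add, neg_add, add_comm, pow_succ, Finset.mul_sum, ← Finset.sum_neg_distrib]
    congr 1
    · simp only [C_mul, C_neg]
      ring
    · refine Finset.sum_congr rfl fun j hj => ?_
      have hj' : n - j = (n - (j + 1)) + 1 := by
        have := Finset.mem_range.mp hj
        omega
      rw [hj', pow_succ]
      simp only [C_mul, C_neg]
      ring
  have h3 : e (n + 1) = X * taylor (-1) (e n) - C a * e n := by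
    rw [sub_eq_add_neg, h1, h2]
    simp only [he]
    rw [Finset.sum_range_succ']
    simp only [descPochhammer_zero, Nat.choose_zero_right, Nat.cast_one, mul_one, Nat.sub_zero,
      Nat.add_sub_add_right, Nat.choose_succ_succ, Nat.cast_add, mul_add, C_add, add_mul,
      Finset.sum_add_distrib]
    ring
  have hc : ∀ n, charlier a n = C (1 / (n.factorial : ℝ)) * e n := fun n => rfl
  rw [hc, hc, h3, taylor_mul, taylor_C, ← mul_assoc, ← C_mul]
  have : ((n : ℝ) + 1) * (1 / ((n + 1).factorial : ℝ)) = 1 / (n.factorial : ℝ) := by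
    rw [Nat.factorial_succ]
    push_cast
    field_simp
  rw [this]
  ring

theorem taylor_one_charlier_succ (a : ℝ) (n : ℕ) :
    taylor 1 (charlier a (n + 1)) - charlier a (n + 1) = charlier a n := by
  induction n with
  | zero =>
    have h := charlier_succ a 0
    simp only [zero_add, Nat.cast_zero, C_1, one_mul, charlier_zero, taylor_one, mul_one] at h
    rw [zero_add, h]
    simp
  | succ n ih =>
    have h := charlier_succ a (n + 1)
    have h' := charlier_succ a n
    have hne : (C (((n + 1 : ℕ) : ℝ) + 1) : ℝ[X]) ≠ 0 := by
      rw [Ne, C_eq_zero]; positivity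
    apply mul_left_cancel₀ hne
    have ht := congrArg (taylor 1) h
    have ht2 := congrArg (taylor (-1)) ih
    simp only [map_sub, taylor_mul, taylor_C, taylor_X, taylor_taylor, add_neg_cancel,
      neg_add_cancel, taylor_zero] at ht ht2
    rw [mul_sub, ht, h]
    push_cast
    simp only [C_add, C_1] at h' ⊢
    linear_combination X * ht2 - C a * ih - h'

theorem natDegree_charlier_le (a : ℝ) (n : ℕ) :
    (charlier a n).natDegree ≤ n ∧ (charlier a n).coeff n = 1 / (n.factorial : ℝ) := by
  rw [charlier, coeff_C_mul, finsetSum_coeff]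
  constructor
  · refine (natDegree_C_mul_le _ _).trans (natDegree_sum_le_of_forall_le _ _ fun j hj => ?_)
    refine (natDegree_C_mul_le _ _).trans ?_
    rw [descPochhammer_natDegree]
    have := Finset.mem_range.mp hj
    omega
  · rw [Finset.sum_range_succ, Finset.sum_eq_zero]
    · have : (descPochhammer ℝ n).coeff n = 1 := by
        have := (monic_descPochhammer ℝ n).coeff_natDegree
        rwa [descPochhammer_natDegree] at this
      simp [this]
    · intro j hj
      rw [coeff_C_mul, coeff_eq_zero_of_natDegree_lt, mul_zero]
      rw [descPochhammer_natDegree]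
      exact Finset.mem_range.mp hj

/-- Both sides equal Σ_j (-b)^(g+y-j) (g choose j)(y choose j) j!, which is symmetric in g and y. -/
theorem charlier_duality (b : ℝ) (g y : ℕ) :
    (g.factorial : ℝ) * (-b) ^ y * (charlier b g).eval (y : ℝ)
      = (y.factorial : ℝ) * (-b) ^ g * (charlier b y).eval (g : ℝ) := by
  have key : ∀ g y : ℕ, (g.factorial : ℝ) * (-b) ^ y * (charlier b g).eval (y : ℝ)
      = ∑ j ∈ Finset.range (g + y + 1),
        (-b) ^ (g + y - j) * (g.choose j : ℝ) * (y.choose j : ℝ) * (j.factorial : ℝ) := by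
    intro g y
    have hg : (g.factorial : ℝ) ≠ 0 := by positivity
    have hsub : Finset.range (g + 1) ⊆ Finset.range (g + y + 1) := by
      intro j
      simp only [Finset.mem_range]
      omega
    rw [charlier, eval_mul, eval_C, eval_finsetSum, ← Finset.sum_subset hsub, Finset.mul_sum,
      Finset.mul_sum]
    · refine Finset.sum_congr rfl fun j hj => ?_
      have hj' : g + y - j = (g - j) + y := by
        have := Finset.mem_range.mp hj
        omega
      rw [eval_mul, eval_C, descPochhammer_eval_eq_descFactorial,
        Nat.descFactorial_eq_factorial_mul_choose, hj', pow_add]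
      push_cast
      field_simp
    · intro j _ hj
      rw [Finset.mem_range, not_lt] at hj
      simp [Nat.choose_eq_zero_of_lt (show g < j by omega)]
  rw [key, key, add_comm g y]
  exact Finset.sum_congr rfl fun j _ => by ring

theorem forwardDiff_natDegree_coeff {s : ℝ[X]} {n : ℕ} (hs : s.natDegree ≤ n + 1) :
    (taylor 1 s - s).natDegree ≤ n ∧
      (taylor 1 s - s).coeff n = ((n : ℝ) + 1) * s.coeff (n + 1) := by
  have h : taylor 1 s - s = ∑ k ∈ Finset.range (n + 2),
      C (s.coeff k) * ((X + C 1) ^ k - X ^ k) := by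
    conv_lhs => rw [as_sum_range_C_mul_X_pow' s (show s.natDegree < n + 2 by omega)]
    rw [map_sum, ← Finset.sum_sub_distrib]
    refine Finset.sum_congr rfl fun k _ => ?_
    rw [taylor_mul, taylor_C, taylor_X_pow, mul_sub]
  have hc : ∀ k d : ℕ, ((X + C (1 : ℝ)) ^ k - X ^ k).coeff d
      = (k.choose d : ℝ) - if d = k then 1 else 0 := by
    intro k d
    rw [coeff_sub, coeff_X_pow, C_1, coeff_X_add_one_pow]
  constructor
  · rw [natDegree_le_iff_coeff_eq_zero]
    intro d hd
    rw [h, finsetSum_coeff]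
    refine Finset.sum_eq_zero fun k hk => ?_
    rw [coeff_C_mul, hc]
    have := Finset.mem_range.mp hk
    rcases eq_or_ne d k with rfl | hne
    · simp
    · rw [Nat.choose_eq_zero_of_lt (by omega), if_neg hne]
      simp
  · rw [h, finsetSum_coeff, Finset.sum_range_succ, Finset.sum_eq_zero]
    · rw [coeff_C_mul, hc]
      simp
      ring
    · intro k hk
      rw [coeff_C_mul, hc]
      have := Finset.mem_range.mp hk
      rcases eq_or_ne n k with rfl | hne
      · simp
      · rw [Nat.choose_eq_zero_of_lt (by omega), if_neg hne]
        simp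

/-! ### The Charlier functional: shift identity, orthogonality, nondegeneracy. -/

/-- Reindexing, from x a^x / x! = a · a^(x-1) / (x-1)!. -/
theorem charlierMeasure_X_mul (a : ℝ) (p : ℝ[X]) :
    charlierMeasure a (X * taylor (-1) p) = a * charlierMeasure a p := by
  change (∑' x : ℕ, (X * taylor (-1) p).eval (x : ℝ) * (a ^ x / (x.factorial : ℝ)))
    = a * ∑' x : ℕ, p.eval (x : ℝ) * (a ^ x / (x.factorial : ℝ))
  rw [(summable_charlier a (X * taylor (-1) p)).tsum_eq_zero_add, ← tsum_mul_left]
  simp only [eval_mul, eval_X, taylor_eval, Nat.cast_zero, zero_mul, zero_add]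
  refine tsum_congr fun x => ?_
  rw [Nat.factorial_succ]
  push_cast
  rw [add_neg_cancel_right, pow_succ]
  field_simp

theorem charlierMeasure_one (a : ℝ) : charlierMeasure a 1 = Real.exp a := by
  change (∑' x : ℕ, (1 : ℝ[X]).eval (x : ℝ) * (a ^ x / (x.factorial : ℝ))) = _
  rw [Real.exp_eq_exp_ℝ, NormedSpace.exp_eq_tsum_div]
  simp

/-- By the shift identity the raising operator is adjoint to a times the forward difference Δ: (n +
1)∫ c_{n+1} s = a ∫ c_n Δs. Each step lowers both the index and the degree of s. -/
theorem charlierMeasure_charlier_mul (a : ℝ) (n : ℕ) (s : ℝ[X]) (hs : s.natDegree ≤ n) :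
    charlierMeasure a (charlier a n * s) = a ^ n * Real.exp a * s.coeff n := by
  induction n generalizing s with
  | zero =>
    rw [eq_C_of_natDegree_le_zero hs, charlier_zero, one_mul, ← mul_one (C (s.coeff 0)),
      ← smul_eq_C_mul, map_smul, charlierMeasure_one]
    simp [mul_comm]
  | succ n ih =>
    obtain ⟨h1, h2⟩ := forwardDiff_natDegree_coeff hs
    have h3 := ih _ h1
    have hne : ((n : ℝ) + 1) ≠ 0 := by positivity
    apply mul_left_cancel₀ hne
    have h4 : ((n : ℝ) + 1) • (charlier a (n + 1) * s)
        = X * taylor (-1) (charlier a n * taylor 1 s) - a • (charlier a n * s) := by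
      rw [smul_eq_C_mul, smul_eq_C_mul, ← mul_assoc, charlier_succ, taylor_mul, taylor_taylor,
        neg_add_cancel, taylor_zero]
      ring
    rw [← smul_eq_mul, ← map_smul, h4, map_sub, charlierMeasure_X_mul, map_smul, smul_eq_mul,
      ← mul_sub, ← map_sub, ← mul_sub, h3, h2]
    ring

theorem charlierMeasure_nondegenerate {a : ℝ} (ha : a ≠ 0) {u : ℝ[X]}
    (hu : ∀ s, charlierMeasure a (u * s) = 0) : u = 0 := by
  by_contra hne
  have h := charlierMeasure_charlier_mul a u.natDegree u le_rfl
  rw [mul_comm, hu] at h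
  have : u.leadingCoeff ≠ 0 := leadingCoeff_ne_zero.mpr hne
  have h' : a ^ u.natDegree * Real.exp a * u.coeff u.natDegree ≠ 0 :=
    mul_ne_zero (mul_ne_zero (pow_ne_zero _ ha) (Real.exp_ne_zero a)) this
  exact h' h.symm

theorem charlier_linearIndependent (a : ℝ) (N : ℕ) (θ : ℕ → ℝ)
    (h : ∑ k ∈ Finset.range N, θ k • charlier a k = 0) : ∀ k < N, θ k = 0 := by
  induction N with
  | zero => intro k hk; omega
  | succ N ih =>
    have hN : θ N = 0 := by
      have hc := congrArg (fun p => coeff p N) h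
      simp only [finsetSum_coeff, coeff_smul, coeff_zero, smul_eq_mul] at hc
      rw [Finset.sum_range_succ, Finset.sum_eq_zero, zero_add, (natDegree_charlier_le a N).2] at hc
      · have : (1 / (N.factorial : ℝ)) ≠ 0 := by positivity
        exact (mul_eq_zero.mp hc).resolve_right this
      · intro k hk
        rw [coeff_eq_zero_of_natDegree_lt, mul_zero]
        exact lt_of_le_of_lt (natDegree_charlier_le a k).1 (Finset.mem_range.mp hk)
    rw [Finset.sum_range_succ, hN, zero_smul, add_zero] at h
    intro k hk
    rcases Nat.lt_succ_iff_lt_or_eq.mp hk with h' | rfl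
    · exact ih h k h'
    · exact hN

/-! ### Integer indices, and moments against falling products with a factor removed. -/

/-- The Charlier polynomials indexed by the integers, vanishing at negative indices. -/
noncomputable def charlierInt (a : ℝ) : ℤ → ℝ[X]
  | Int.ofNat n => charlier a n
  | Int.negSucc _ => 0

theorem charlierInt_natCast (a : ℝ) (n : ℕ) : charlierInt a (n : ℤ) = charlier a n := rfl

theorem charlierInt_of_neg (a : ℝ) {k : ℤ} (hk : k < 0) : charlierInt a k = 0 := by
  cases k with
  | ofNat n => exact absurd hk (by simp)
  | negSucc n => rfl

theorem charlierInt_sub_of_le (a : ℝ) {n j : ℕ} (h : j ≤ n) :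
    charlierInt a ((n : ℤ) - (j : ℤ)) = charlier a (n - j) := by
  rw [← Nat.cast_sub h, charlierInt_natCast]

theorem taylor_prod {ι : Type*} (r : ℝ) (s : Finset ι) (f : ι → ℝ[X]) :
    taylor r (∏ i ∈ s, f i) = ∏ i ∈ s, taylor r (f i) :=
  map_prod (taylorAlgHom r) f s

theorem charlierMeasure_taylor_charlier (a : ℝ) (n : ℕ) :
    charlierMeasure a (taylor (-1) (charlier a n)) = (-1) ^ n * Real.exp a := by
  induction n with
  | zero => simp [charlierMeasure_one]
  | succ n ih =>
    have h := congrArg (taylor (-1)) (taylor_one_charlier_succ a n)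
    rw [map_sub, taylor_taylor, neg_add_cancel, taylor_zero] at h
    have h0 := charlierMeasure_charlier_mul a (n + 1) 1 (by simp)
    rw [mul_one, coeff_one, if_neg (by omega), mul_zero] at h0
    have h1 := congrArg (charlierMeasure a) h
    rw [map_sub, h0, ih] at h1
    rw [pow_succ]
    linarith

/-- The product of the factors `X - i`, `i < N`, `i ≠ k`. -/
noncomputable def puncturedProd (N k : ℕ) : ℝ[X] :=
  ∏ i ∈ Finset.range N, if i = k then 1 else (X - C (i : ℝ))

theorem puncturedProd_eq {N k : ℕ} (h : k < N) :
    (X - C (k : ℝ)) * puncturedProd N k = ∏ i ∈ Finset.range N, (X - C (i : ℝ)) := by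
  have hk : k ∈ Finset.range N := Finset.mem_range.mpr h
  rw [puncturedProd, ← Finset.mul_prod_erase _ _ hk, ← Finset.mul_prod_erase _ _ hk, if_pos rfl,
    one_mul]
  congr 1
  refine Finset.prod_congr rfl fun i hi => ?_
  rw [if_neg (Finset.ne_of_mem_erase hi)]

/-- These moments produce the dual family c_g^{-a}. For k = 0, the raising relation at a translated
point absorbs each new factor, and both sides satisfy the same recurrence in g. Raising k shifts the
whole integrand and costs a factor a. -/
theorem charlierMeasure_puncturedProd (a : ℝ) (k g n : ℕ) :
    charlierMeasure a (puncturedProd (k + g + 1) k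
        * taylor (-((k + g + 1 : ℕ) : ℝ)) (charlier a n))
      = (-1) ^ n * a ^ k * Real.exp a * (g.factorial : ℝ)
        * (charlier (-a) g).eval (-(n : ℝ) - 1) := by
  induction k with
  | zero =>
    induction g generalizing n with
    | zero =>
      simp [puncturedProd, charlierMeasure_taylor_charlier]
    | succ g ih =>
      have hp : puncturedProd (0 + (g + 1) + 1) 0
          = puncturedProd (0 + g + 1) 0 * (X - C ((0 + g + 1 : ℕ) : ℝ)) := by
        rw [puncturedProd, Finset.prod_range_succ, if_neg (by omega), puncturedProd]
        rfl
      have h := congrArg (taylor (-((0 + g + 1 : ℕ) : ℝ))) (charlier_succ a n)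
      simp only [map_sub, taylor_mul, taylor_C, taylor_X, taylor_taylor] at h
      have hs : -((0 + g + 1 : ℕ) : ℝ) + -1 = -((0 + (g + 1) + 1 : ℕ) : ℝ) := by
        push_cast; ring
      rw [hs] at h
      have e : puncturedProd (0 + (g + 1) + 1) 0
            * taylor (-((0 + (g + 1) + 1 : ℕ) : ℝ)) (charlier a n)
          = ((n : ℝ) + 1) • (puncturedProd (0 + g + 1) 0
              * taylor (-((0 + g + 1 : ℕ) : ℝ)) (charlier a (n + 1)))
            + a • (puncturedProd (0 + g + 1) 0
              * taylor (-((0 + g + 1 : ℕ) : ℝ)) (charlier a n)) := by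
        rw [hp, smul_eq_C_mul, smul_eq_C_mul]
        rw [C_neg] at h
        linear_combination (-puncturedProd (0 + g + 1) 0) * h
      have h2 := congrArg (eval (-(n : ℝ) - 1)) (charlier_succ (-a) g)
      simp only [eval_mul, eval_sub, eval_C, eval_X, taylor_eval] at h2
      rw [e, map_add, map_smul, map_smul, ih, ih, smul_eq_mul, smul_eq_mul, Nat.factorial_succ]
      have hz : -((n + 1 : ℕ) : ℝ) - 1 = -(n : ℝ) - 1 + -1 := by push_cast; ring
      rw [hz, pow_succ]
      push_cast
      linear_combination (-(-1) ^ n * a ^ 0 * Real.exp a * (g.factorial : ℝ)) * h2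
  | succ k ih =>
    have hp : puncturedProd (k + 1 + g + 1) (k + 1)
        = X * taylor (-1) (puncturedProd (k + g + 1) k) := by
      rw [show k + 1 + g + 1 = (k + g + 1) + 1 by ring, puncturedProd, Finset.prod_range_succ',
        if_neg (by omega), mul_comm, puncturedProd, taylor_prod]
      congr 1
      · simp
      · refine Finset.prod_congr rfl fun i _ => ?_
        by_cases hi : i = k
        · simp [hi]
        · rw [if_neg hi, if_neg (by omega), map_sub, taylor_X, taylor_C]
          push_cast
          simp only [C_add, C_neg, C_1]
          ring
    have ht : taylor (-((k + 1 + g + 1 : ℕ) : ℝ)) (charlier a n)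
        = taylor (-1) (taylor (-((k + g + 1 : ℕ) : ℝ)) (charlier a n)) := by
      rw [taylor_taylor]
      congr 2
      push_cast
      ring
    rw [hp, ht, mul_assoc, ← taylor_mul, charlierMeasure_X_mul, ih, pow_succ]
    ring

theorem charlierMeasure_prod_range (a : ℝ) (L : ℕ) (u : ℝ[X]) :
    charlierMeasure a ((∏ i ∈ Finset.range L, (X - C (i : ℝ))) * taylor (-(L : ℝ)) u)
      = a ^ L * charlierMeasure a u := by
  induction L with
  | zero => simp
  | succ L ih =>
    have hp : (∏ i ∈ Finset.range (L + 1), (X - C (i : ℝ)))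
        = X * taylor (-1) (∏ i ∈ Finset.range L, (X - C (i : ℝ))) := by
      rw [Finset.prod_range_succ', mul_comm, taylor_prod]
      congr 1
      · simp
      · refine Finset.prod_congr rfl fun i _ => ?_
        rw [map_sub, taylor_X, taylor_C]
        push_cast
        simp only [C_add, C_neg, C_1]
        ring
    have ht : taylor (-((L + 1 : ℕ) : ℝ)) u = taylor (-1) (taylor (-(L : ℝ)) u) := by
      rw [taylor_taylor]
      congr 2
      push_cast
      ring
    rw [hp, ht, mul_assoc, ← taylor_mul, charlierMeasure_X_mul, ih, pow_succ]
    ring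

/-! ### Gaps of F and combinations orthogonal for ρ_a^F. -/

section Complement

variable {F : Finset ℕ} {L m : ℕ} {κ g : Fin m → ℕ}

theorem prod_mul_nodal (hκ : ∀ i, κ i + g i + 1 = L) (hinj : Function.Injective κ)
    (hF : ∀ x, x ∈ F ↔ x < L ∧ ∀ i, κ i ≠ x) :
    (∏ f ∈ F, (X - C (f : ℝ))) * Lagrange.nodal Finset.univ (fun i => (κ i : ℝ))
      = ∏ i ∈ Finset.range L, (X - C (i : ℝ)) := by
  have hsub : F ⊆ Finset.range L := fun x hx => Finset.mem_range.mpr ((hF x).mp hx).1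
  have hc : Finset.range L \ F = Finset.univ.image κ := by
    ext x
    simp only [Finset.mem_sdiff, Finset.mem_range, hF, Finset.mem_image, Finset.mem_univ, true_and]
    constructor
    · rintro ⟨h1, h2⟩
      by_contra h
      exact h2 ⟨h1, fun i hi => h ⟨i, hi⟩⟩
    · rintro ⟨i, rfl⟩
      exact ⟨by have := hκ i; omega, fun h => h.2 i rfl⟩
  rw [← Finset.prod_sdiff hsub, hc, Finset.prod_image (fun x _ y _ h => hinj h), mul_comm]
  rfl

theorem prod_mul_prod_erase (hκ : ∀ i, κ i + g i + 1 = L) (hinj : Function.Injective κ)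
    (hF : ∀ x, x ∈ F ↔ x < L ∧ ∀ i, κ i ≠ x) (i : Fin m) :
    (∏ f ∈ F, (X - C (f : ℝ))) * ∏ j ∈ Finset.univ.erase i, (X - C (κ j : ℝ))
      = puncturedProd L (κ i) := by
  have hi : κ i < L := by have := hκ i; omega
  apply mul_left_cancel₀ (X_sub_C_ne_zero (κ i : ℝ))
  rw [puncturedProd_eq hi, ← prod_mul_nodal hκ hinj hF, Lagrange.nodal_eq,
    ← Finset.mul_prod_erase _ _ (Finset.mem_univ i)]
  ring

/-- Duality turns the sum into a divided difference at m nodes of f(x) c_y^{-a}(L - 1 - x), up to a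
constant. The degree is below m - 1, so it vanishes. This disposes of the indices j > n, where
c_{n-j} = 0 but the relations for γ still contain a term. -/
theorem sum_divided_difference_charlier {a : ℝ} (ha : a ≠ 0) (hκ : ∀ i, κ i + g i + 1 = L)
    (hinj : Function.Injective κ) (f : ℝ[X]) (y : ℕ) (hf : f.natDegree + y + 1 < m) :
    ∑ i, f.eval (κ i : ℝ) / (∏ j ∈ Finset.univ.erase i, ((κ i : ℝ) - κ j))
      * (a ^ κ i * (g i).factorial * (charlier (-a) (g i)).eval (y : ℝ)) = 0 := by
  set P : ℝ[X] := f * (charlier (-a) y).comp (C ((L : ℝ) - 1) - X) with hP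
  have hdeg : P.natDegree < m - 1 := by
    have h1 : ((charlier (-a) y).comp (C ((L : ℝ) - 1) - X)).natDegree ≤ y := by
      refine natDegree_comp_le.trans ?_
      have : (C ((L : ℝ) - 1) - X : ℝ[X]).natDegree ≤ 1 := by
        refine (natDegree_sub_le _ _).trans ?_
        rw [natDegree_C, natDegree_X]
        simp
      calc _ ≤ y * 1 := Nat.mul_le_mul (natDegree_charlier_le _ _).1 this
        _ = y := mul_one y
    have h2 : P.natDegree ≤ _ := natDegree_mul_le
    omega
  have hv : Set.InjOn (fun i => (κ i : ℝ)) (Finset.univ : Finset (Fin m)) := by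
    intro i _ j _ h
    exact hinj (Nat.cast_injective (R := ℝ) h)
  have hlt : P.degree < (Finset.univ : Finset (Fin m)).card := by
    rw [Finset.card_univ, Fintype.card_fin]
    exact lt_of_le_of_lt degree_le_natDegree (by exact_mod_cast (by omega : P.natDegree < m))
  have hsum := Lagrange.coeff_eq_sum hv hlt
  rw [Finset.card_univ, Fintype.card_fin, coeff_eq_zero_of_natDegree_lt hdeg] at hsum
  have hterm : ∀ i, f.eval (κ i : ℝ) / (∏ j ∈ Finset.univ.erase i, ((κ i : ℝ) - κ j))
      * (a ^ κ i * (g i).factorial * (charlier (-a) (g i)).eval (y : ℝ))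
      = P.eval (κ i : ℝ) / (∏ j ∈ Finset.univ.erase i, ((κ i : ℝ) - κ j))
        * (a ^ (L - 1) * (y.factorial : ℝ) / a ^ y) := by
    intro i
    have hd := charlier_duality (-a) (g i) y
    rw [neg_neg] at hd
    have hL : a ^ (L - 1) = a ^ κ i * a ^ g i := by
      rw [← pow_add]
      congr 1
      have := hκ i
      omega
    have hg : (L : ℝ) - 1 - (κ i : ℝ) = (g i : ℝ) := by
      have : ((κ i + g i + 1 : ℕ) : ℝ) = L := by rw [hκ i]
      push_cast at this
      linarith
    have hy : a ^ y ≠ 0 := pow_ne_zero _ ha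
    have hc : a ^ κ i * (g i).factorial * (charlier (-a) (g i)).eval (y : ℝ)
        = (charlier (-a) y).eval (g i : ℝ) * (a ^ κ i * a ^ g i * (y.factorial : ℝ) / a ^ y) := by
      field_simp
      linear_combination hd
    rw [hP, eval_mul, eval_comp, eval_sub, eval_C, eval_X, hg, hL, hc]
    ring
  rw [Finset.sum_congr rfl fun i _ => hterm i, ← Finset.sum_mul, ← hsum, zero_mul]

/-- The combination `∑_{j ≤ m} γ_j c_{n-j}`, where `c_k = 0` for `k < 0`. -/
noncomputable def charlierComb (a : ℝ) (n m : ℕ) (γ : ℕ → ℝ) : ℝ[X] :=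
  ∑ j ∈ Finset.range (m + 1), γ j • charlierInt a ((n : ℤ) - j)

theorem charlierChristoffel_comb_mul_eq_zero {a : ℝ} (ha : a ≠ 0)
    (hκ : ∀ i, κ i + g i + 1 = L) (hinj : Function.Injective κ)
    (hF : ∀ x, x ∈ F ↔ x < L ∧ ∀ i, κ i ≠ x) {n : ℕ} {γ : ℕ → ℝ}
    (hγ : ∀ i, ∑ j ∈ Finset.range (m + 1),
      (-1) ^ j * γ j * (charlier (-a) (g i)).eval (-((n : ℝ) - j) - 1) = 0)
    {s : ℝ[X]} (hs : s.degree < n) :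
    charlierChristoffel a F (taylor (-(L : ℝ)) (charlierComb a n m γ) * s) = 0 := by
  rcases eq_or_ne s 0 with rfl | hs0
  · simp
  have hn : 0 < n := lt_of_le_of_lt (Nat.zero_le _) ((natDegree_lt_iff_degree_lt hs0).mpr hs)
  set nod : ℝ[X] := Lagrange.nodal Finset.univ (fun i => (κ i : ℝ)) with hnod
  have hmon : nod.Monic := Lagrange.nodal_monic
  have hnd : nod.natDegree = m := by simp [hnod]
  -- Multiples of the nodal polynomial are handled by translating the full falling product. The
  -- remainder is handled by interpolation at the κ_i and the relations on γ.
  rw [← modByMonic_add_div s nod, mul_add, map_add]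
  have hdef : ∀ u, charlierChristoffel a F u
      = charlierMeasure a ((∏ f ∈ F, (X - C (f : ℝ))) * u) := fun u => rfl
  have hA : charlierChristoffel a F
      (taylor (-(L : ℝ)) (charlierComb a n m γ) * (nod * (s /ₘ nod))) = 0 := by
    set u := s /ₘ nod with hu
    rw [hdef]
    have e : (∏ f ∈ F, (X - C (f : ℝ)))
        * (taylor (-(L : ℝ)) (charlierComb a n m γ) * (nod * u))
        = (∏ i ∈ Finset.range L, (X - C (i : ℝ)))
          * taylor (-(L : ℝ)) (charlierComb a n m γ * taylor (L : ℝ) u) := by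
      rw [← prod_mul_nodal hκ hinj hF, taylor_mul, taylor_taylor, neg_add_cancel, taylor_zero]
      ring
    rw [e, charlierMeasure_prod_range, charlierComb, Finset.sum_mul, map_sum,
      Finset.sum_eq_zero, mul_zero]
    intro j hj
    have hjm := Finset.mem_range.mp hj
    rw [smul_mul_assoc, map_smul]
    by_cases hjn : j ≤ n
    · rw [charlierInt_sub_of_le a hjn]
      by_cases hu0 : u = 0
      · simp [hu0]
      · have h1 : nod.degree ≤ s.degree := by
          by_contra hlt
          exact hu0 ((divByMonic_eq_zero_iff hmon).mpr (not_le.mp hlt))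
        have h2 : m ≤ s.natDegree := by
          rw [← hnd]
          exact natDegree_le_natDegree h1
        have h3 : s.natDegree < n := (natDegree_lt_iff_degree_lt hs0).mpr hs
        have h4 : u.natDegree = s.natDegree - m := by
          rw [hu, natDegree_divByMonic s hmon, hnd]
        have h5 : (taylor (L : ℝ) u).natDegree < n - j := by
          rw [natDegree_taylor]
          omega
        rw [charlierMeasure_charlier_mul a (n - j) _ h5.le, coeff_eq_zero_of_natDegree_lt h5]
        simp
    · rw [charlierInt_of_neg a (by omega)]
      simp
  have hB : charlierChristoffel a F
      (taylor (-(L : ℝ)) (charlierComb a n m γ) * (s %ₘ nod)) = 0 := by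
    set s₀ := s %ₘ nod with hs₀
    have hv : Set.InjOn (fun i => (κ i : ℝ)) (Finset.univ : Finset (Fin m)) := by
      intro i _ j _ h
      exact hinj (Nat.cast_injective (R := ℝ) h)
    have hdm : s₀.degree < (Finset.univ : Finset (Fin m)).card := by
      have := degree_modByMonic_lt s hmon
      rwa [hnod, Lagrange.degree_nodal, ← hnod] at this
    have hdn : s₀.degree < n := lt_of_le_of_lt (degree_modByMonic_le_left) hs
    have hint := (Lagrange.eq_interpolate hv hdm).symm
    rw [Lagrange.interpolate_eq_sum] at hint
    set w : Fin m → ℝ := fun i =>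
      s₀.eval (κ i : ℝ) / (∏ j ∈ Finset.univ.erase i, ((κ i : ℝ) - κ j)) with hw
    have e : (∏ f ∈ F, (X - C (f : ℝ))) * (taylor (-(L : ℝ)) (charlierComb a n m γ) * s₀)
        = ∑ j ∈ Finset.range (m + 1), γ j • ∑ i, w i •
          (puncturedProd L (κ i) * taylor (-(L : ℝ)) (charlierInt a ((n : ℤ) - j))) := by
      conv_lhs => rw [← hint]
      simp only [charlierComb, map_sum, map_smul, Finset.mul_sum, Finset.sum_mul, Finset.smul_sum]
      rw [Finset.sum_comm]
      refine Finset.sum_congr rfl fun j _ => Finset.sum_congr rfl fun i _ => ?_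
      rw [← prod_mul_prod_erase hκ hinj hF i]
      simp only [smul_eq_C_mul, hw]
      ring
    have hW : ∀ j ∈ Finset.range (m + 1), charlierMeasure a (∑ i, w i •
          (puncturedProd L (κ i) * taylor (-(L : ℝ)) (charlierInt a ((n : ℤ) - j))))
        = (-1) ^ n * Real.exp a * ∑ i, w i * (a ^ κ i * (g i).factorial *
          ((-1) ^ j * (charlier (-a) (g i)).eval (-((n : ℝ) - j) - 1))) := by
      intro j hj
      have hjm := Finset.mem_range.mp hj
      rw [map_sum]
      by_cases hjn : j ≤ n
      · rw [Finset.mul_sum]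
        refine Finset.sum_congr rfl fun i _ => ?_
        rw [map_smul, charlierInt_sub_of_le a hjn]
        have h := charlierMeasure_puncturedProd a (κ i) (g i) (n - j)
        rw [hκ i, Nat.cast_sub hjn] at h
        have hpow : (-1 : ℝ) ^ (n - j) = (-1) ^ n * (-1) ^ j := by
          rw [← pow_add, show n + j = (n - j) + 2 * j by omega, pow_add, pow_mul]
          simp
        rw [h, hpow, smul_eq_mul]
        ring
      -- Here j > n. The degree bound holds because deg s₀ < n and j ≤ m; if s₀ = 0, it needs n > 0.
      · have hz := sum_divided_difference_charlier ha hκ hinj s₀ (j - n - 1) (by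
          by_cases h0 : s₀ = 0
          · rw [h0, natDegree_zero]
            omega
          · have := (natDegree_lt_iff_degree_lt h0).mpr hdn
            omega)
        have hc : ((j - n - 1 : ℕ) : ℝ) = -((n : ℝ) - j) - 1 := by
          rw [Nat.sub_sub, Nat.cast_sub (by omega)]
          push_cast
          ring
        rw [hc] at hz
        rw [Finset.sum_eq_zero fun i _ => by rw [charlierInt_of_neg a (by omega)]; simp]
        have : ∑ i, w i * (a ^ κ i * (g i).factorial *
            ((-1) ^ j * (charlier (-a) (g i)).eval (-((n : ℝ) - j) - 1))) = 0 := by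
          rw [← mul_zero ((-1 : ℝ) ^ j), ← hz, Finset.mul_sum]
          exact Finset.sum_congr rfl fun i _ => by ring
        rw [this, mul_zero]
    rw [hdef, e, map_sum]
    simp only [map_smul]
    rw [Finset.sum_congr rfl fun j hj => by rw [hW j hj]]
    have : ∑ j ∈ Finset.range (m + 1), γ j • ((-1) ^ n * Real.exp a *
        ∑ i, w i * (a ^ κ i * (g i).factorial *
          ((-1) ^ j * (charlier (-a) (g i)).eval (-((n : ℝ) - j) - 1))))
        = ∑ i, ((-1) ^ n * Real.exp a * (w i * (a ^ κ i * (g i).factorial))) *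
          ∑ j ∈ Finset.range (m + 1),
            (-1) ^ j * γ j * (charlier (-a) (g i)).eval (-((n : ℝ) - j) - 1) := by
      simp only [smul_eq_mul, Finset.mul_sum]
      rw [Finset.sum_comm]
      exact Finset.sum_congr rfl fun i _ => Finset.sum_congr rfl fun j _ => by ring
    rw [this]
    exact Finset.sum_eq_zero fun i _ => by rw [hγ i, mul_zero]
  rw [hA, hB, add_zero]

end Complement

theorem charlierInt_natDegree_le (a : ℝ) (n j : ℕ) :
    (charlierInt a ((n : ℤ) - j)).natDegree ≤ n - j := by
  by_cases h : j ≤ n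
  · rw [charlierInt_sub_of_le a h]
    exact (natDegree_charlier_le a _).1
  · rw [charlierInt_of_neg a (by omega), natDegree_zero]
    exact Nat.zero_le _

theorem charlierComb_natDegree_coeff (a : ℝ) {n m j : ℕ} (γ : ℕ → ℝ) (hjn : j ≤ n) (hjm : j ≤ m)
    (h : ∀ i < j, γ i = 0) :
    (charlierComb a n m γ).natDegree ≤ n - j ∧
      (charlierComb a n m γ).coeff (n - j) = γ j / ((n - j).factorial : ℝ) := by
  constructor
  · refine natDegree_sum_le_of_forall_le _ _ fun i _ => ?_
    by_cases hi : i < j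
    · simp [h i hi]
    · refine (natDegree_smul_le _ _).trans ((charlierInt_natDegree_le a n i).trans ?_)
      omega
  · rw [charlierComb, finsetSum_coeff, Finset.sum_eq_single j]
    · rw [coeff_smul, charlierInt_sub_of_le a hjn, (natDegree_charlier_le a _).2, smul_eq_mul]
      ring
    · intro i _ hij
      rw [coeff_smul, smul_eq_mul]
      rcases lt_or_gt_of_ne hij with hlt | hgt
      · rw [h i hlt, zero_mul]
      · by_cases hin : i ≤ n
        · rw [coeff_eq_zero_of_natDegree_lt, mul_zero]
          refine lt_of_le_of_lt (charlierInt_natDegree_le a n i) ?_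
          omega
        · rw [charlierInt_of_neg a (by omega), coeff_zero, mul_zero]
    · intro hj
      exact absurd (Finset.mem_range.mpr (by omega)) hj

/-! ### Uniqueness for orthogonal sequences. -/

section Regular

variable {μ : ℝ[X] →ₗ[ℝ] ℝ} {q : ℕ → ℝ[X]}

theorem exists_sub_degree_lt {k : ℕ} {p t : ℝ[X]} (hp : p.degree = (k : WithBot ℕ))
    (ht : t.degree < ((k + 1 : ℕ) : WithBot ℕ)) : ∃ c : ℝ, (t - c • p).degree < (k : WithBot ℕ) := by
  have hk : p.natDegree = k := natDegree_eq_of_degree_eq_some hp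
  have hne : p.coeff k ≠ 0 := by
    rw [← hk]
    refine leadingCoeff_ne_zero.mpr ?_
    rintro rfl
    simp at hp
  refine ⟨t.coeff k / p.coeff k, ?_⟩
  rw [degree_lt_iff_coeff_zero] at ht ⊢
  intro d hd
  rw [coeff_sub, coeff_smul, smul_eq_mul]
  rcases hd.eq_or_lt with rfl | hlt
  · field_simp
    simp
  · rw [ht d hlt, coeff_eq_zero_of_natDegree_lt (hk.trans_lt hlt)]
    simp

theorem map_mul_eq_zero_of_degree_lt (hq : ∀ n, (q n).degree = (n : WithBot ℕ)) {p : ℝ[X]} {n : ℕ}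
    (h : ∀ k < n, μ (p * q k) = 0) {s : ℝ[X]} (hs : s.degree < (n : WithBot ℕ)) :
    μ (p * s) = 0 := by
  induction n generalizing s with
  | zero =>
    have : s = 0 := by
      rw [← degree_eq_bot]
      exact Nat.WithBot.lt_zero_iff.mp (by exact_mod_cast hs)
    simp [this]
  | succ n ih =>
    obtain ⟨c, hc⟩ := exists_sub_degree_lt (hq n) hs
    have h1 := ih (fun k hk => h k (by omega)) hc
    rw [mul_sub, map_sub, mul_smul_comm, map_smul, h n (by omega), smul_zero, sub_zero] at h1
    exact h1

theorem IsOrthogonalSequence.map_mul_eq_zero (hq : IsOrthogonalSequence μ q) {n : ℕ} {s : ℝ[X]}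
    (hs : s.degree < (n : WithBot ℕ)) : μ (q n * s) = 0 :=
  map_mul_eq_zero_of_degree_lt hq.degree_eq (fun k hk => hq.orthogonal n k (by omega)) hs

theorem IsOrthogonalSequence.eq_zero (hq : IsOrthogonalSequence μ q) {n : ℕ} {p : ℝ[X]}
    (hp : p.degree < (n : WithBot ℕ)) (h : ∀ s : ℝ[X], s.degree < (n : WithBot ℕ) → μ (p * s) = 0) :
    p = 0 := by
  induction n with
  | zero =>
    rw [← degree_eq_bot]
    exact Nat.WithBot.lt_zero_iff.mp (by exact_mod_cast hp)
  | succ n ih =>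
    obtain ⟨c, hc⟩ := exists_sub_degree_lt (hq.degree_eq n) hp
    have h1 := hq.map_mul_eq_zero hc
    have h2 := h (q n) (by rw [hq.degree_eq n]; exact_mod_cast Nat.lt_succ_self n)
    have hn := hq.norm_ne_zero n
    rw [mul_sub, map_sub, mul_comm, h2, mul_smul_comm, map_smul, ← pow_two, zero_sub, neg_eq_zero,
      smul_eq_mul] at h1
    have hc0 : c = 0 := (mul_eq_zero.mp h1).resolve_right hn
    rw [hc0, zero_smul, sub_zero] at hc
    exact ih hc fun s hs => h s (hs.trans (by exact_mod_cast Nat.lt_succ_self n))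

end Regular

/-! ### The Casorati determinant and existence of orthogonal sequences. -/

section Complement

variable {F : Finset ℕ} {L m : ℕ} {κ g : Fin m → ℕ} {a : ℝ}

/-- The matrix of the Casorati determinant of `c_{g_l}^{-a}`, at a real point. -/
noncomputable def casoratiMatrix (a : ℝ) (g : Fin m → ℕ) (x : ℝ) : Matrix (Fin m) (Fin m) ℝ :=
  Matrix.of fun l j => (charlier (-a) (g l)).eval (-(x - ((j : ℕ) + 1)) - 1)

/-- The sequence `c, -v_0, v_1, -v_2, …`, continued by `0`. -/
noncomputable def alternatingExtend (c : ℝ) (v : Fin m → ℝ) : ℕ → ℝ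
  | 0 => c
  | j + 1 => if h : j < m then (-1) ^ (j + 1) * v ⟨j, h⟩ else 0

theorem sum_alternatingExtend (c : ℝ) (v : Fin m → ℝ) (y : ℕ → ℝ) :
    ∑ j ∈ Finset.range (m + 1), (-1) ^ j * alternatingExtend c v j * y j
      = (∑ j : Fin m, v j * y (j + 1)) + c * y 0 := by
  rw [Finset.sum_range_succ', Finset.sum_range]
  congr 1
  · refine Finset.sum_congr rfl fun j _ => ?_
    rw [alternatingExtend, dif_pos j.2, ← mul_assoc, ← mul_pow]
    simp
  · simp [alternatingExtend]

/-- The signs cancel, so the relations on γ become a linear system with the Casorati matrix. It is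
used with c = 1 to solve the system and with c = 0 for a kernel vector. -/
theorem sum_alternatingExtend_charlier (c : ℝ) (v : Fin m → ℝ) (n : ℕ) (i : Fin m) :
    ∑ j ∈ Finset.range (m + 1), (-1) ^ j * alternatingExtend c v j
        * (charlier (-a) (g i)).eval (-((n : ℝ) - j) - 1)
      = (casoratiMatrix a g n).mulVec v i + c * (charlier (-a) (g i)).eval (-(n : ℝ) - 1) := by
  rw [sum_alternatingExtend c v fun j => (charlier (-a) (g i)).eval (-((n : ℝ) - j) - 1)]
  congr 1
  · refine Finset.sum_congr rfl fun j _ => ?_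
    change _ = (charlier (-a) (g i)).eval (-((n : ℝ) - ((j : ℕ) + 1)) - 1) * v j
    push_cast
    ring
  · simp

theorem exists_charlier_relation {n : ℕ} (h : (casoratiMatrix a g n).det ≠ 0) :
    ∃ γ : ℕ → ℝ, γ 0 = 1 ∧ ∀ i, ∑ j ∈ Finset.range (m + 1),
      (-1) ^ j * γ j * (charlier (-a) (g i)).eval (-((n : ℝ) - j) - 1) = 0 := by
  refine ⟨alternatingExtend 1 ((casoratiMatrix a g n)⁻¹.mulVec
    fun i => -(charlier (-a) (g i)).eval (-(n : ℝ) - 1)), rfl, fun i => ?_⟩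
  rw [sum_alternatingExtend_charlier, Matrix.mulVec_mulVec,
    Matrix.mul_nonsing_inv _ (isUnit_iff_ne_zero.mpr h), Matrix.one_mulVec]
  ring

theorem charlierComb_degree {n : ℕ} {γ : ℕ → ℝ} (hγ : γ 0 = 1) :
    (taylor (-(L : ℝ)) (charlierComb a n m γ)).degree = (n : WithBot ℕ) := by
  obtain ⟨h1, h2⟩ := charlierComb_natDegree_coeff a (m := m) γ (Nat.zero_le n) (Nat.zero_le m)
    (by simp)
  rw [Nat.sub_zero] at h1 h2
  rw [degree_taylor]
  refine degree_eq_of_le_of_coeff_ne_zero (natDegree_le_iff_degree_le.mp h1) ?_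
  rw [h2, hγ]
  positivity

theorem exists_isOrthogonalSequence (ha : a ≠ 0) (hκ : ∀ i, κ i + g i + 1 = L)
    (hinj : Function.Injective κ) (hF : ∀ x, x ∈ F ↔ x < L ∧ ∀ i, κ i ≠ x)
    (h : ∀ n : ℕ, (casoratiMatrix a g n).det ≠ 0) :
    ∃ q, IsOrthogonalSequence (charlierChristoffel a F) q := by
  choose γ hγ0 hγ using fun n => exists_charlier_relation (h n)
  set q : ℕ → ℝ[X] := fun n => taylor (-(L : ℝ)) (charlierComb a n m (γ n)) with hq
  have hdeg : ∀ n, (q n).degree = (n : WithBot ℕ) := fun n => charlierComb_degree (hγ0 n)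
  have horth : ∀ (n : ℕ) (s : ℝ[X]), s.degree < (n : WithBot ℕ) → charlierChristoffel a F (q n * s) = 0 :=
    fun n s hs => charlierChristoffel_comb_mul_eq_zero ha hκ hinj hF (hγ n) hs
  have hne : ∀ n k, n ≠ k → charlierChristoffel a F (q n * q k) = 0 := by
    intro n k hnk
    rcases lt_or_gt_of_ne hnk with hlt | hgt
    · rw [mul_comm]
      exact horth k _ (by rw [hdeg]; exact_mod_cast hlt)
    · exact horth n _ (by rw [hdeg]; exact_mod_cast hgt)
  refine ⟨q, hdeg, hne, fun n hn => ?_⟩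
  -- If the norm vanished, q_n would be orthogonal to all polynomials, and nondegeneracy of ρ_a
  -- would give ∏ (x - f) q_n = 0.
  have hall : ∀ s, charlierChristoffel a F (q n * s) = 0 := by
    intro s
    refine map_mul_eq_zero_of_degree_lt hdeg (n := s.natDegree + 1) (fun k _ => ?_) ?_
    · rcases eq_or_ne n k with rfl | hnk
      · rw [← pow_two, hn]
      · exact hne n k hnk
    · exact lt_of_le_of_lt degree_le_natDegree (by exact_mod_cast Nat.lt_succ_self _)
  have h0 : (∏ f ∈ F, (X - C (f : ℝ))) * q n = 0 := by
    refine charlierMeasure_nondegenerate ha fun s => ?_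
    rw [mul_assoc]
    exact hall s
  rcases mul_eq_zero.mp h0 with h1 | h1
  · rw [Finset.prod_eq_zero_iff] at h1
    obtain ⟨f, _, hf⟩ := h1
    exact X_sub_C_ne_zero _ hf
  · have := hdeg n
    rw [h1] at this
    simp at this

/-- A kernel vector yields a combination of degree < n orthogonal to all polynomials of degree < n.
Such a combination is zero, and this forces the kernel vector to vanish. -/
theorem casoratiMatrix_det_ne_zero (ha : a ≠ 0) (hκ : ∀ i, κ i + g i + 1 = L)
    (hinj : Function.Injective κ) (hF : ∀ x, x ∈ F ↔ x < L ∧ ∀ i, κ i ≠ x) {q : ℕ → ℝ[X]}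
    (hq : IsOrthogonalSequence (charlierChristoffel a F) q) (n : ℕ) :
    (casoratiMatrix a g n).det ≠ 0 := by
  intro hdet
  obtain ⟨v, hv, hAv⟩ := Matrix.exists_mulVec_eq_zero_iff.mpr hdet
  set γ := alternatingExtend 0 v with hγdef
  have hγ : ∀ i, ∑ j ∈ Finset.range (m + 1),
      (-1) ^ j * γ j * (charlier (-a) (g i)).eval (-((n : ℝ) - j) - 1) = 0 := by
    intro i
    rw [sum_alternatingExtend_charlier, hAv]
    simp
  have hγ0 : γ 0 = 0 := rfl
  set P := charlierComb a n m γ with hP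
  have hPdeg : P.degree < (n : WithBot ℕ) := by
    obtain ⟨h1, h2⟩ := charlierComb_natDegree_coeff a (m := m) γ (Nat.zero_le n) (Nat.zero_le m)
      (by simp)
    rw [Nat.sub_zero] at h1 h2
    rw [degree_lt_iff_coeff_zero]
    intro d hd
    rcases hd.eq_or_lt with rfl | hlt
    · rw [hP, h2, hγ0, zero_div]
    · exact coeff_eq_zero_of_natDegree_lt (lt_of_le_of_lt h1 hlt)
  have hP0 : P = 0 := by
    rw [← taylor_eq_zero (-(L : ℝ))]
    refine hq.eq_zero (n := n) (by rwa [degree_taylor]) fun s hs => ?_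
    exact charlierChristoffel_comb_mul_eq_zero ha hκ hinj hF hγ hs
  have hlow : ∀ j, j ≤ n → j ≤ m → γ j = 0 := by
    intro j
    induction j using Nat.strong_induction_on with
    | _ j ih =>
      intro hjn hjm
      have h2 := (charlierComb_natDegree_coeff a γ hjn hjm
        fun i hi => ih i hi (by omega) (by omega)).2
      rw [← hP, hP0, coeff_zero, eq_comm, div_eq_zero_iff] at h2
      exact h2.resolve_right (by positivity)
  -- For indices beyond n the combination carries no information, since c_{n-j} = 0. The relations
  -- do: by duality they say that a polynomial of degree < m - n vanishes at the m points g_i, so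
  -- its Charlier coefficients are zero.
  have hhigh : ∀ y < m - n, γ (n + 1 + y) = 0 := by
    rcases le_or_gt m n with hmn | hmn
    · intro y hy
      omega
    set θ : ℕ → ℝ := fun y => (-1) ^ (n + 1 + y) * γ (n + 1 + y) * ((y.factorial : ℝ) / a ^ y)
      with hθ
    have hzero : ∑ y ∈ Finset.range (m - n), θ y • charlier (-a) y = 0 := by
      have hgv : Set.InjOn (fun i => (g i : ℝ)) (Finset.univ : Finset (Fin m)) := by
        intro i _ j _ hij
        have hij' : g i = g j := Nat.cast_injective (R := ℝ) hij
        apply hinj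
        have h1 := hκ i
        have h2 := hκ j
        omega
      refine eq_zero_of_degree_lt_of_eval_index_eq_zero (s := Finset.univ) hgv ?_
        fun i _ => ?_
      · rw [Finset.card_univ, Fintype.card_fin, degree_lt_iff_coeff_zero]
        intro d hd
        rw [finsetSum_coeff]
        refine Finset.sum_eq_zero fun y hy => ?_
        rw [coeff_smul, coeff_eq_zero_of_natDegree_lt, smul_zero]
        refine lt_of_le_of_lt (natDegree_charlier_le _ _).1 ?_
        have := Finset.mem_range.mp hy
        omega
      · have h := hγ i
        rw [show m + 1 = (n + 1) + (m - n) by omega, Finset.sum_range_add,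
          Finset.sum_eq_zero fun j hj => by
            have := Finset.mem_range.mp hj
            rw [hlow j (by omega) (by omega)]
            simp, zero_add] at h
        have hg0 : (a ^ g i / ((g i).factorial : ℝ)) ≠ 0 :=
          div_ne_zero (pow_ne_zero _ ha) (by positivity)
        apply mul_left_cancel₀ hg0
        rw [mul_zero, ← h, eval_finsetSum, Finset.mul_sum]
        refine Finset.sum_congr rfl fun y _ => ?_
        have hd := charlier_duality (-a) (g i) y
        rw [neg_neg] at hd
        have hy : -((n : ℝ) - (n + 1 + y : ℕ)) - 1 = (y : ℝ) := by
          push_cast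
          ring
        have hay : a ^ y ≠ 0 := pow_ne_zero _ ha
        rw [hy, eval_smul, smul_eq_mul, hθ]
        field_simp
        linear_combination (-γ (n + 1 + y)) * hd
    intro y hy
    have h1 := charlier_linearIndependent (-a) (m - n) θ hzero y hy
    have h2 : ((y.factorial : ℝ) / a ^ y) ≠ 0 := div_ne_zero (by positivity) (pow_ne_zero _ ha)
    have h3 : ((-1 : ℝ) ^ (n + 1 + y)) ≠ 0 := pow_ne_zero _ (by norm_num)
    exact (mul_eq_zero.mp ((mul_eq_zero.mp h1).resolve_right h2)).resolve_left h3
  apply hv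
  ext j
  have hj : γ (j + 1) = 0 := by
    by_cases hjn : (j : ℕ) + 1 ≤ n
    · exact hlow _ hjn j.2
    · have := hhigh ((j : ℕ) - n) (by omega)
      rwa [show n + 1 + ((j : ℕ) - n) = j + 1 by omega] at this
  rw [hγdef, alternatingExtend, dif_pos j.2] at hj
  exact (mul_eq_zero.mp hj).resolve_left (pow_ne_zero _ (by norm_num))

theorem IsOrthogonalSequence.eq_smul_charlierComb (ha : a ≠ 0) (hκ : ∀ i, κ i + g i + 1 = L)
    (hinj : Function.Injective κ) (hF : ∀ x, x ∈ F ↔ x < L ∧ ∀ i, κ i ≠ x) {q : ℕ → ℝ[X]}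
    (hq : IsOrthogonalSequence (charlierChristoffel a F) q) (n : ℕ) :
    ∃ (c : ℝ) (γ : ℕ → ℝ), (∀ i, ∑ j ∈ Finset.range (m + 1),
      (-1) ^ j * γ j * (charlier (-a) (g i)).eval (-((n : ℝ) - j) - 1) = 0) ∧
      q n = c • taylor (-(L : ℝ)) (charlierComb a n m γ) := by
  obtain ⟨γ, hγ0, hγ⟩ :=
    exists_charlier_relation (casoratiMatrix_det_ne_zero ha hκ hinj hF hq n)
  have hlt : (q n).degree < ((n + 1 : ℕ) : WithBot ℕ) := by
    rw [hq.degree_eq n]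
    exact_mod_cast Nat.lt_succ_self n
  obtain ⟨c, hc⟩ := exists_sub_degree_lt (charlierComb_degree (L := L) (m := m) (a := a) hγ0) hlt
  refine ⟨c, γ, hγ, sub_eq_zero.mp (hq.eq_zero hc fun s hs => ?_)⟩
  rw [sub_mul, map_sub, hq.map_mul_eq_zero hs, smul_mul_assoc, map_smul,
    charlierChristoffel_comb_mul_eq_zero ha hκ hinj hF hγ hs]
  simp

end Complement

/-! ### The operators N and ∇ on Charlier polynomials. -/

/-- The backward difference `∇ p (x) = p (x) - p (x - 1)`. -/
noncomputable def backwardDiff : Module.End ℝ ℝ[X] := LinearMap.id - taylor (-1)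

/-- The second order difference operator whose eigenfunctions are the Charlier polynomials. -/
noncomputable def charlierOp (a : ℝ) : Module.End ℝ ℝ[X] :=
  (LinearMap.mulLeft ℝ X).comp backwardDiff - a • (taylor 1 - LinearMap.id)

theorem backwardDiff_apply (p : ℝ[X]) : backwardDiff p = p - taylor (-1) p := rfl

theorem charlierOp_apply (a : ℝ) (p : ℝ[X]) :
    charlierOp a p = X * (p - taylor (-1) p) - a • (taylor 1 p - p) := rfl

theorem backwardDiff_charlier_succ (a : ℝ) (n : ℕ) :
    backwardDiff (charlier a (n + 1)) = taylor (-1) (charlier a n) := by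
  have h := congrArg (taylor (-1)) (taylor_one_charlier_succ a n)
  rwa [map_sub, taylor_taylor, neg_add_cancel, taylor_zero] at h

theorem charlierOp_charlierInt (a : ℝ) (k : ℤ) :
    charlierOp a (charlierInt a k) = (k : ℝ) • charlierInt a k := by
  rcases lt_or_ge k 0 with hk | hk
  · simp [charlierInt_of_neg a hk]
  · lift k to ℕ using hk
    rw [charlierInt_natCast]
    cases k with
    | zero => simp [charlierOp_apply]
    | succ n =>
      rw [charlierOp_apply, ← backwardDiff_apply, backwardDiff_charlier_succ,
        taylor_one_charlier_succ, smul_eq_C_mul, smul_eq_C_mul]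
      have := charlier_succ a n
      push_cast
      rw [this]

/-- Iterated, this expands ∇c_k as an alternating sum of lower c's. It persists at k = -1 because ∇
kills constants. -/
theorem backwardDiff_charlierInt_add (a : ℝ) (k : ℤ) :
    backwardDiff (charlierInt a (k + 1)) + backwardDiff (charlierInt a k) = charlierInt a k := by
  rcases lt_or_ge k 0 with hk | hk
  · rw [charlierInt_of_neg a hk, map_zero, add_zero]
    rcases lt_or_ge (k + 1) 0 with hk' | hk'
    · rw [charlierInt_of_neg a hk', map_zero]
    · have : k + 1 = ((0 : ℕ) : ℤ) := by
        push_cast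
        omega
      rw [this, charlierInt_natCast, charlier_zero]
      simp [backwardDiff_apply]
  · lift k to ℕ using hk
    have : (k : ℤ) + 1 = ((k + 1 : ℕ) : ℤ) := by push_cast; ring
    rw [this, charlierInt_natCast, charlierInt_natCast, backwardDiff_charlier_succ,
      backwardDiff_apply]
    ring

theorem aeval_charlierOp_charlierInt (a : ℝ) (P : ℝ[X]) (k : ℤ) :
    aeval (charlierOp a) P (charlierInt a k) = P.eval (k : ℝ) • charlierInt a k :=
  Module.End.aeval_apply_of_mem_apply_eq_smul (charlierOp_charlierInt a k)

/-- Summation by parts. The boundary term drops out when the u_l sum to zero, which is what the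
relations on γ provide. -/
theorem backwardDiff_sum_charlierInt (a : ℝ) (n : ℤ) (u : ℕ → ℝ) (M : ℕ) :
    backwardDiff (∑ j ∈ Finset.range M, ((-1) ^ j * u j) • charlierInt a (n - j))
      = -(∑ j ∈ Finset.range M, ((-1) ^ j * ∑ l ∈ Finset.range j, u l) • charlierInt a (n - j))
        - ((-1) ^ M * ∑ l ∈ Finset.range M, u l) • backwardDiff (charlierInt a (n - M + 1)) := by
  induction M with
  | zero => simp
  | succ M ih =>
    have h := backwardDiff_charlierInt_add a (n - M)
    have hM : n - ((M + 1 : ℕ) : ℤ) + 1 = n - M := by push_cast; ring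
    rw [Finset.sum_range_succ, map_add, map_smul, ih, Finset.sum_range_succ (fun j =>
      ((-1 : ℝ) ^ j * ∑ l ∈ Finset.range j, u l) • charlierInt a (n - j)), hM,
      Finset.sum_range_succ u]
    simp only [smul_eq_C_mul, C_mul, C_add, C_pow, C_neg, C_1, pow_succ]
    linear_combination (-(-1) ^ M * C (∑ l ∈ Finset.range M, u l)) * h

/-! ### The eigenvalue identity through Cramer's rule. -/

section Intertwining

variable {m : ℕ}

/-- The matrix `(Y_i (x - j))`, `j = 1, …, m`. -/
noncomputable def shiftMatrix (Y : Fin m → ℝ[X]) (x : ℝ) : Matrix (Fin m) (Fin m) ℝ :=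
  Matrix.of fun i j => (Y i).eval (x - ((j : ℕ) + 1))

theorem cramer_shiftMatrix (Y : Fin m → ℝ[X]) {x z : ℝ} {r : ℕ} (hr : r < m)
    (h : z = x - (r + 1)) (t : Fin m) :
    (shiftMatrix Y x).cramer (fun i => (Y i).eval z) t
      = if r = t then (shiftMatrix Y x).det else 0 := by
  rw [Matrix.cramer_row_self (shiftMatrix Y x) _ ⟨r, hr⟩ fun i => by rw [h]; rfl]
  by_cases hrt : r = t
  · subst hrt
    simp
  · have : t ≠ ⟨r, hr⟩ := fun h => hrt (by rw [h])
    rw [Pi.single_eq_of_ne this, if_neg hrt]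

/-- Each cofactor sum is a determinant with column t replaced by Y(n - l). It vanishes if the new
column repeats another one. The determinants that survive are consecutive values of ∇P and
telescope. -/
theorem sum_sum_cofactor_mul {Y M : Fin m → ℝ[X]} {P : ℝ[X]}
    (hM : ∀ i y, (M i).eval y = ∑ t : Fin m, (shiftMatrix Y (y + ((t : ℕ) + 1))).adjugate t i)
    (hP : ∀ x, P.eval x - P.eval (x - 1) = (shiftMatrix Y x).det) {n : ℝ} {γ : ℕ → ℝ}
    (hγ : ∀ i, ∑ j ∈ Finset.range (m + 1), (-1) ^ j * γ j * (Y i).eval (n - j) = 0)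
    {j : ℕ} (hj : j ≤ m) :
    ∑ i, (M i).eval (n - j) * ∑ l ∈ Finset.range j, (-1) ^ l * γ l * (Y i).eval (n - l)
      = -((-1) ^ j * γ j * (P.eval n - P.eval (n - j))) := by
  set K : Fin m → ℕ → ℝ := fun t l =>
    (shiftMatrix Y (n - j + ((t : ℕ) + 1))).cramer (fun i => (Y i).eval (n - l)) t with hK
  have hKsum : ∀ (t : Fin m) (s : Finset ℕ), ∑ l ∈ s, (-1) ^ l * γ l * K t l
      = ∑ i, (shiftMatrix Y (n - j + ((t : ℕ) + 1))).adjugate t i *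
        ∑ l ∈ s, (-1) ^ l * γ l * (Y i).eval (n - l) := by
    intro t s
    simp only [hK, Matrix.cramer_eq_adjugate_mulVec, Matrix.mulVec, dotProduct, Finset.mul_sum]
    rw [Finset.sum_comm]
    exact Finset.sum_congr rfl fun i _ => Finset.sum_congr rfl fun l _ => by ring
  have hlhs : ∑ i, (M i).eval (n - j) *
      ∑ l ∈ Finset.range j, (-1) ^ l * γ l * (Y i).eval (n - l)
      = ∑ t, ∑ l ∈ Finset.range j, (-1) ^ l * γ l * K t l := by
    simp only [hKsum, hM, Finset.sum_mul]
    rw [Finset.sum_comm]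
  have hterm : ∀ t : Fin m, ∑ l ∈ Finset.range j, (-1) ^ l * γ l * K t l
      = if (t : ℕ) < j then
          -((-1) ^ j * γ j * (shiftMatrix Y (n - j + ((t : ℕ) + 1))).det) else 0 := by
    intro t
    split_ifs with ht
    -- For t < j the relations trade the indices l < j for l ≥ j. Then Y(n - l) is column t + (l -
    -- j) of the matrix, so only l = j survives.
    · have h0 : ∑ l ∈ Finset.range (m + 1), (-1) ^ l * γ l * K t l = 0 := by
        rw [hKsum]
        exact Finset.sum_eq_zero fun i _ => by rw [hγ i, mul_zero]
      rw [show m + 1 = j + (m - j + 1) by omega, Finset.sum_range_add,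
        Finset.sum_range_succ'] at h0
      have h1 : ∑ k ∈ Finset.range (m - j),
          (-1) ^ (j + (k + 1)) * γ (j + (k + 1)) * K t (j + (k + 1)) = 0 := by
        refine Finset.sum_eq_zero fun k hk => ?_
        have hk' := Finset.mem_range.mp hk
        rw [hK]
        dsimp only
        rw [cramer_shiftMatrix Y (r := t + (k + 1)) (by omega) (by push_cast; ring),
          if_neg (by omega), mul_zero]
      have h2 : K t (j + 0) = (shiftMatrix Y (n - j + ((t : ℕ) + 1))).det := by
        rw [hK]
        dsimp only
        rw [cramer_shiftMatrix Y (r := t) t.2 (by push_cast; ring), if_pos rfl]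
      rw [h1, h2, add_zero] at h0
      linarith
    -- For t ≥ j the vector Y(n - l) is already column t - (j - l), different from t, so nothing
    -- survives.
    · refine Finset.sum_eq_zero fun l hl => ?_
      have hl' := Finset.mem_range.mp hl
      rw [hK]
      dsimp only
      rw [cramer_shiftMatrix Y (r := t - (j - l)) (by omega) (by
        rw [Nat.cast_sub (by omega), Nat.cast_sub (by omega)]
        ring), if_neg (by omega), mul_zero]
  have htel : ∀ k : ℕ, ∑ t ∈ Finset.range k, (shiftMatrix Y (n - j + ((t : ℝ) + 1))).det
      = P.eval (n - j + k) - P.eval (n - j) := by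
    intro k
    induction k with
    | zero => simp
    | succ k ih =>
      rw [Finset.sum_range_succ, ih, ← hP]
      push_cast
      rw [show n - (j : ℝ) + ((k : ℝ) + 1) - 1 = n - j + k by ring]
      ring
  rw [hlhs, Finset.sum_congr rfl fun t _ => hterm t,
    ← Finset.sum_range (fun t : ℕ => if t < j then
      -((-1) ^ j * γ j * (shiftMatrix Y (n - j + ((t : ℝ) + 1))).det) else 0), ← Finset.sum_filter]
  have hfilter : (Finset.range m).filter (fun t => t < j) = Finset.range j := by
    ext t
    simp only [Finset.mem_filter, Finset.mem_range]
    omega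
  rw [hfilter, Finset.sum_neg_distrib, ← Finset.mul_sum, htel, sub_add_cancel]

/-- The difference operator `P(N) + ∑_i M_i(N) ∇ Y_i(N)`, where `N` is the Charlier operator. -/
noncomputable def krallOp (a : ℝ) (P : ℝ[X]) (M Y : Fin m → ℝ[X]) : Module.End ℝ ℝ[X] :=
  aeval (charlierOp a) P
    + ∑ i, aeval (charlierOp a) (M i) * (backwardDiff * aeval (charlierOp a) (Y i))

theorem krallOp_charlierComb (a : ℝ) {Y M : Fin m → ℝ[X]} {P : ℝ[X]}
    (hM : ∀ i y, (M i).eval y = ∑ t : Fin m, (shiftMatrix Y (y + ((t : ℕ) + 1))).adjugate t i)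
    (hP : ∀ x, P.eval x - P.eval (x - 1) = (shiftMatrix Y x).det) {n : ℕ} {γ : ℕ → ℝ}
    (hγ : ∀ i, ∑ j ∈ Finset.range (m + 1), (-1) ^ j * γ j * (Y i).eval ((n : ℝ) - j) = 0) :
    krallOp a P M Y (charlierComb a n m γ) = P.eval (n : ℝ) • charlierComb a n m γ := by
  have haeval : ∀ (Q : ℝ[X]) (θ : ℕ → ℝ), aeval (charlierOp a) Q
      (∑ j ∈ Finset.range (m + 1), θ j • charlierInt a ((n : ℤ) - j))
      = ∑ j ∈ Finset.range (m + 1), (θ j * Q.eval ((n : ℝ) - j)) •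
        charlierInt a ((n : ℤ) - j) := by
    intro Q θ
    rw [map_sum]
    refine Finset.sum_congr rfl fun j _ => ?_
    rw [map_smul, aeval_charlierOp_charlierInt, smul_smul]
    push_cast
    rfl
  have hi : ∀ i, (aeval (charlierOp a) (M i) * (backwardDiff * aeval (charlierOp a) (Y i)))
      (charlierComb a n m γ) = ∑ j ∈ Finset.range (m + 1),
        (-(-1) ^ j * ((M i).eval ((n : ℝ) - j) *
          ∑ l ∈ Finset.range j, (-1) ^ l * γ l * (Y i).eval ((n : ℝ) - l))) •
        charlierInt a ((n : ℤ) - j) := by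
    intro i
    have h1 := backwardDiff_sum_charlierInt a n
      (fun j => (-1) ^ j * γ j * (Y i).eval ((n : ℝ) - j)) (m + 1)
    rw [hγ i, mul_zero, zero_smul, sub_zero, ← Finset.sum_neg_distrib] at h1
    rw [Module.End.mul_apply, Module.End.mul_apply, charlierComb, haeval]
    have h2 : ∑ j ∈ Finset.range (m + 1),
        (γ j * (Y i).eval ((n : ℝ) - j)) • charlierInt a ((n : ℤ) - j)
        = ∑ j ∈ Finset.range (m + 1), ((-1) ^ j * ((-1) ^ j * γ j * (Y i).eval ((n : ℝ) - j))) •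
          charlierInt a ((n : ℤ) - j) := by
      refine Finset.sum_congr rfl fun j _ => ?_
      congr 1
      rw [← mul_assoc, ← mul_assoc, ← mul_pow]
      simp
    rw [h2, h1]
    simp only [← neg_smul]
    rw [haeval]
    refine Finset.sum_congr rfl fun j _ => ?_
    congr 1
    ring
  rw [krallOp, LinearMap.add_apply, LinearMap.sum_apply, Finset.sum_congr rfl fun i _ => hi i,
    Finset.sum_comm]
  simp only [← Finset.sum_smul, ← Finset.mul_sum]
  rw [charlierComb, haeval, ← Finset.sum_add_distrib, Finset.smul_sum]
  refine Finset.sum_congr rfl fun j hj => ?_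
  rw [sum_sum_cofactor_mul hM hP hγ (Nat.lt_succ_iff.mp (Finset.mem_range.mp hj)), ← add_smul,
    smul_smul]
  congr 1
  have : ((-1 : ℝ) ^ j) * (-1) ^ j = 1 := by rw [← mul_pow]; simp
  linear_combination (γ j * (P.eval (n : ℝ) - P.eval ((n : ℝ) - j))) * this

end Intertwining

/-! ### Extreme coefficients of difference operators. -/

/-- The operator `∑_l h_l(x) 𝔰_l` with finitely many polynomial coefficients. -/
noncomputable def shiftSum (h : ℤ →₀ ℝ[X]) (p : ℝ[X]) : ℝ[X] :=
  h.sum fun l u => u * taylor (l : ℝ) p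

theorem shiftSum_add (h k : ℤ →₀ ℝ[X]) (p : ℝ[X]) :
    shiftSum (h + k) p = shiftSum h p + shiftSum k p :=
  Finsupp.sum_add_index' (fun _ => zero_mul _) fun _ _ _ => add_mul _ _ _

theorem shiftSum_smul (u : ℝ[X]) (h : ℤ →₀ ℝ[X]) (p : ℝ[X]) :
    shiftSum (u • h) p = u * shiftSum h p := by
  rw [shiftSum, Finsupp.sum_smul_index' fun _ => zero_mul _, shiftSum, Finsupp.mul_sum]
  simp only [smul_eq_mul, mul_assoc]

/-- The coefficients of `𝔰_k ∘ D`, where `D` has the coefficients `h`. -/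
noncomputable def shiftCoeffs (k : ℤ) (h : ℤ →₀ ℝ[X]) : ℤ →₀ ℝ[X] :=
  (h.mapRange (taylor (k : ℝ)) (map_zero _)).equivMapDomain (Equiv.addRight k)

theorem shiftCoeffs_apply (k : ℤ) (h : ℤ →₀ ℝ[X]) (l : ℤ) :
    shiftCoeffs k h l = taylor (k : ℝ) (h (l - k)) := by
  simp [shiftCoeffs, sub_eq_add_neg]

theorem shiftSum_shiftCoeffs (k : ℤ) (h : ℤ →₀ ℝ[X]) (p : ℝ[X]) :
    shiftSum (shiftCoeffs k h) p = taylor (k : ℝ) (shiftSum h p) := by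
  rw [shiftSum, shiftCoeffs, Finsupp.sum_equivMapDomain,
    Finsupp.sum_mapRange_index fun _ => zero_mul _, shiftSum, Finsupp.sum, Finsupp.sum, map_sum]
  refine Finset.sum_congr rfl fun l _ => ?_
  rw [taylor_mul, taylor_taylor]
  simp [add_comm]

/-- `D = ∑_{l=s}^r h_l(x) 𝔰_l`, where `h_r` is the constant `v` and `h_s` has degree at most `d`,
with `w` as coefficient of `x ^ d`. -/
def HasSymbol (D : Module.End ℝ ℝ[X]) (s r : ℤ) (d : ℕ) (w v : ℝ) : Prop :=
  ∃ h : ℤ →₀ ℝ[X], (∀ p, D p = shiftSum h p) ∧ (∀ l < s, h l = 0) ∧ (∀ l, r < l → h l = 0) ∧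
    h r = C v ∧ (h s).natDegree ≤ d ∧ (h s).coeff d = w

namespace HasSymbol

variable {D D' : Module.End ℝ ℝ[X]} {s r : ℤ} {d : ℕ} {w w' v v' : ℝ}

theorem one : HasSymbol 1 0 0 0 1 1 := by
  refine ⟨Finsupp.single 0 1, fun p => ?_, fun l hl => ?_, fun l hl => ?_, ?_, ?_, ?_⟩
  · simp [shiftSum]
  · rw [Finsupp.single_eq_of_ne (by omega)]
  · rw [Finsupp.single_eq_of_ne (by omega)]
  all_goals simp

theorem zero (s r : ℤ) (d : ℕ) : HasSymbol 0 s r d 0 0 :=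
  ⟨0, fun p => by simp [shiftSum], by simp, by simp, by simp, by simp, by simp⟩

theorem add (h : HasSymbol D s r d w v) (h' : HasSymbol D' s r d w' v') :
    HasSymbol (D + D') s r d (w + w') (v + v') := by
  obtain ⟨k, h1, h2, h3, h4, h5, h6⟩ := h
  obtain ⟨k', h1', h2', h3', h4', h5', h6'⟩ := h'
  refine ⟨k + k', fun p => ?_, fun l hl => ?_, fun l hl => ?_, ?_, ?_, ?_⟩
  · rw [LinearMap.add_apply, shiftSum_add, h1, h1']
  · rw [Finsupp.add_apply, h2 l hl, h2' l hl, add_zero]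
  · rw [Finsupp.add_apply, h3 l hl, h3' l hl, add_zero]
  · rw [Finsupp.add_apply, h4, h4', C_add]
  · exact natDegree_add_le_of_degree_le h5 h5'
  · rw [Finsupp.add_apply, coeff_add, h6, h6']

theorem smul (c : ℝ) (h : HasSymbol D s r d w v) : HasSymbol (c • D) s r d (c * w) (c * v) := by
  obtain ⟨k, h1, h2, h3, h4, h5, h6⟩ := h
  refine ⟨(C c : ℝ[X]) • k, fun p => ?_, fun l hl => ?_, fun l hl => ?_, ?_, ?_, ?_⟩
  · rw [LinearMap.smul_apply, shiftSum_smul, h1, smul_eq_C_mul]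
  · rw [Finsupp.smul_apply, h2 l hl, smul_zero]
  · rw [Finsupp.smul_apply, h3 l hl, smul_zero]
  · rw [Finsupp.smul_apply, h4, smul_eq_mul, C_mul]
  · rw [Finsupp.smul_apply, smul_eq_mul]
    exact (natDegree_C_mul_le _ _).trans h5
  · rw [Finsupp.smul_apply, smul_eq_mul, coeff_C_mul, h6]

theorem sum {ι : Type*} {A : ι → Module.End ℝ ℝ[X]} (t : Finset ι)
    (h : ∀ i ∈ t, HasSymbol (A i) s r d 0 0) : HasSymbol (∑ i ∈ t, A i) s r d 0 0 := by
  classical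
  induction t using Finset.induction_on with
  | empty => exact zero s r d
  | insert i t hi ih =>
    rw [Finset.sum_insert hi]
    have := (h i (Finset.mem_insert_self i t)).add
      (ih fun j hj => h j (Finset.mem_insert_of_mem hj))
    rwa [add_zero] at this

theorem widen (h : HasSymbol D s r d w v) {s' r' : ℤ} (d' : ℕ) (hs : s' < s) (hr : r < r') :
    HasSymbol D s' r' d' 0 0 := by
  obtain ⟨k, h1, h2, h3, h4, h5, h6⟩ := h
  refine ⟨k, h1, fun l hl => h2 l (hl.trans hs), fun l hl => h3 l (hr.trans hl), ?_, ?_, ?_⟩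
  · rw [h3 _ hr, C_0]
  · rw [h2 _ hs]
    simp
  · rw [h2 _ hs]
    simp

theorem widen_right (h : HasSymbol D s r d w v) {r' : ℤ} (hr : r < r') :
    HasSymbol D s r' d w 0 := by
  obtain ⟨k, h1, h2, h3, h4, h5, h6⟩ := h
  exact ⟨k, h1, h2, fun l hl => h3 l (hr.trans hl), by rw [h3 _ hr, C_0], h5, h6⟩

theorem mono_degree (h : HasSymbol D s r d w v) {d' : ℕ} (hd : d < d') :
    HasSymbol D s r d' 0 v := by
  obtain ⟨k, h1, h2, h3, h4, h5, h6⟩ := h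
  exact ⟨k, h1, h2, h3, h4, h5.trans hd.le, coeff_eq_zero_of_natDegree_lt (h5.trans_lt hd)⟩

theorem natDegree_coeff_taylor {u : ℝ[X]} (hu : u.natDegree ≤ d) (c : ℝ) :
    (taylor c u).natDegree ≤ d ∧ (taylor c u).coeff d = u.coeff d := by
  refine ⟨by rwa [natDegree_taylor], ?_⟩
  rcases hu.eq_or_lt with rfl | hlt
  · exact coeff_taylor_natDegree c u
  · rw [coeff_eq_zero_of_natDegree_lt hlt, coeff_eq_zero_of_natDegree_lt]
    rwa [natDegree_taylor]

theorem backwardDiff_mul (h : HasSymbol D s r d w v) :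
    HasSymbol (backwardDiff * D) (s - 1) r d (-w) v := by
  obtain ⟨k, h1, h2, h3, h4, h5, h6⟩ := h
  have hk : ∀ l, (k + (-1 : ℝ[X]) • shiftCoeffs (-1) k) l
      = k l - taylor (-1) (k (l + 1)) := by
    intro l
    rw [Finsupp.add_apply, Finsupp.smul_apply, shiftCoeffs_apply]
    simp [sub_eq_add_neg]
  have ht := natDegree_coeff_taylor h5 (-1)
  refine ⟨k + (-1 : ℝ[X]) • shiftCoeffs (-1) k, fun p => ?_, fun l hl => ?_, fun l hl => ?_,
    ?_, ?_, ?_⟩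
  · rw [shiftSum_add, shiftSum_smul, shiftSum_shiftCoeffs, Module.End.mul_apply,
      backwardDiff_apply, h1]
    simp [sub_eq_add_neg]
  · rw [hk, h2 l (by omega), h2 (l + 1) (by omega)]
    simp
  · rw [hk, h3 l (by omega), h3 (l + 1) (by omega)]
    simp
  · rw [hk, h3 (r + 1) (by omega), h4]
    simp
  · rw [hk, h2 (s - 1) (by omega), sub_add_cancel, zero_sub, natDegree_neg]
    exact ht.1
  · rw [hk, h2 (s - 1) (by omega), sub_add_cancel, zero_sub, coeff_neg, ht.2, h6]

/-- N = (x + a) - x 𝔰_{-1} - a 𝔰_1: the left end gains a factor -x, while the right end stays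
constant. -/
theorem charlierOp_mul (a : ℝ) (h : HasSymbol D s r d w v) :
    HasSymbol (charlierOp a * D) (s - 1) (r + 1) (d + 1) (-w) (-a * v) := by
  obtain ⟨k, h1, h2, h3, h4, h5, h6⟩ := h
  have hk : ∀ l, ((X + C a : ℝ[X]) • k + (-X : ℝ[X]) • shiftCoeffs (-1) k
      + (-C a : ℝ[X]) • shiftCoeffs 1 k) l
      = (X + C a) * k l - X * taylor (-1) (k (l + 1)) - C a * taylor 1 (k (l - 1)) := by
    intro l
    simp only [Finsupp.add_apply, Finsupp.smul_apply, shiftCoeffs_apply, smul_eq_mul,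
      sub_neg_eq_add]
    push_cast
    ring
  have ht := natDegree_coeff_taylor h5 (-1)
  refine ⟨(X + C a : ℝ[X]) • k + (-X : ℝ[X]) • shiftCoeffs (-1) k
    + (-C a : ℝ[X]) • shiftCoeffs 1 k, fun p => ?_, fun l hl => ?_, fun l hl => ?_, ?_, ?_, ?_⟩
  · simp only [shiftSum_add, shiftSum_smul, shiftSum_shiftCoeffs, Module.End.mul_apply,
      charlierOp_apply, h1, smul_eq_C_mul]
    push_cast
    ring
  · rw [hk, h2 l (by omega), h2 (l + 1) (by omega), h2 (l - 1) (by omega)]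
    simp
  · rw [hk, h3 l (by omega), h3 (l + 1) (by omega), h3 (l - 1) (by omega)]
    simp
  · rw [hk, h3 (r + 1) (by omega), h3 (r + 1 + 1) (by omega), add_sub_cancel_right, h4]
    simp
  · rw [hk, h2 (s - 1) (by omega), h2 (s - 1 - 1) (by omega), sub_add_cancel]
    simp only [mul_zero, map_zero, zero_sub, sub_zero, natDegree_neg]
    refine natDegree_mul_le.trans ?_
    rw [natDegree_X]
    omega
  · rw [hk, h2 (s - 1) (by omega), h2 (s - 1 - 1) (by omega), sub_add_cancel]
    simp only [mul_zero, map_zero, zero_sub, sub_zero, coeff_neg, coeff_X_mul, ht.2, h6]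

/-- Horner's scheme: every step but the last coefficient multiplies by N, and the lower terms do not
reach the ends. -/
theorem aeval_charlierOp_mul (a : ℝ) (h : HasSymbol D s r d w v) {P : ℝ[X]} {e : ℕ}
    (hP : P.natDegree ≤ e) :
    HasSymbol (aeval (charlierOp a) P * D) (s - e) (r + e) (d + e) ((-1) ^ e * P.coeff e * w)
      ((-a) ^ e * P.coeff e * v) := by
  induction e generalizing P with
  | zero =>
    rw [eq_C_of_natDegree_le_zero hP, aeval_C, Algebra.algebraMap_eq_smul_one, smul_mul_assoc,
      one_mul]
    simpa using h.smul (P.coeff 0)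
  | succ e ih =>
    have hd : P.divX.natDegree ≤ e := by
      rw [natDegree_divX_eq_natDegree_tsub_one]
      omega
    have h1 := ((ih hd).charlierOp_mul a).add
      ((h.smul (P.coeff 0)).widen (s' := s - e - 1) (r' := r + e + 1) (d + e + 1)
        (by omega) (by omega))
    have hD : aeval (charlierOp a) P * D
        = charlierOp a * (aeval (charlierOp a) P.divX * D) + P.coeff 0 • D := by
      conv_lhs => rw [← P.divX_mul_X_add]
      rw [mul_comm P.divX X, map_add, aeval_C, map_mul, aeval_X, add_mul,
        Algebra.algebraMap_eq_smul_one, smul_mul_assoc, one_mul, mul_assoc]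
    rw [hD]
    convert h1 using 1
    · push_cast; ring
    · push_cast; ring
    · rfl
    · rw [coeff_divX, pow_succ]; ring
    · rw [coeff_divX, pow_succ]; ring

theorem isDifferenceOperator {R : ℤ} (h : HasSymbol D (-R) R d w v) (hR : 0 ≤ R) (hw : w ≠ 0)
    (hv : v ≠ 0) (c : ℝ) :
    IsDifferenceOperator ((taylor (-c)).comp (D.comp (taylor c))) (-R) R := by
  obtain ⟨k, h1, h2, h3, h4, h5, h6⟩ := h
  refine ⟨by omega, fun l => taylor (-c) (k l), ?_, ?_, fun p => ?_⟩
  · rw [Ne, taylor_eq_zero]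
    intro h0
    rw [h0, coeff_zero] at h6
    exact hw h6.symm
  · rw [Ne, taylor_eq_zero, h4, C_eq_zero]
    exact hv
  · have hsub : k.support ⊆ Finset.Icc (-R) R := by
      intro l hl
      rw [Finsupp.mem_support_iff] at hl
      rw [Finset.mem_Icc]
      by_contra hcon
      rcases lt_or_ge l (-R) with hlt | hge
      · exact hl (h2 l hlt)
      · exact hl (h3 l (by omega))
    rw [LinearMap.comp_apply, LinearMap.comp_apply, h1, shiftSum,
      Finsupp.sum_of_support_subset _ hsub _ (by simp), map_sum]
    refine Finset.sum_congr rfl fun l _ => ?_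
    rw [taylor_mul, taylor_taylor, taylor_taylor, ← taylor_apply, neg_add_cancel_comm]

end HasSymbol

/-! ### Degrees of the Casorati determinant and of the cofactor sums. -/

section Degrees

theorem sum_range_card_le_sum (s : Finset ℕ) : ∑ i ∈ Finset.range s.card, i ≤ ∑ i ∈ s, i := by
  induction s using Finset.induction_on_max with
  | empty => simp
  | insert a s hlt ih =>
    have ha : a ∉ s := fun h => lt_irrefl a (hlt a h)
    have hcard : s.card ≤ a := by
      have : s ⊆ Finset.range a := fun x hx => Finset.mem_range.mpr (hlt x hx)
      simpa using Finset.card_le_card this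
    rw [Finset.card_insert_of_notMem ha, Finset.sum_range_succ, Finset.sum_insert ha]
    omega

variable {m : ℕ}

theorem sum_range_le_sum_of_injective {e : Fin m → ℕ} (he : Function.Injective e) :
    ∑ i ∈ Finset.range m, i ≤ ∑ i, e i := by
  have h := sum_range_card_le_sum (Finset.univ.image e)
  rwa [Finset.card_image_of_injective _ he, Finset.card_univ, Fintype.card_fin,
    Finset.sum_image fun x _ y _ hxy => he hxy] at h

/-- Antisymmetrization over the nodes `0, …, m - 1` lowers the degree in the remaining variable by
`0 + 1 + ⋯ + (m - 1)`. -/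
theorem coeff_sum_sign_aeval_eq_zero (H : MvPolynomial (Option (Fin m)) ℝ) {d : ℕ}
    (hd : H.totalDegree < d + ∑ i ∈ Finset.range m, i) :
    (∑ σ : Equiv.Perm (Fin m), ((Equiv.Perm.sign σ : ℤ) : ℝ) •
      MvPolynomial.aeval (fun o : Option (Fin m) =>
        o.elim (X : ℝ[X]) fun l => C (((σ l : Fin m) : ℕ) : ℝ)) H).coeff d = 0 := by
  have hmon : ∀ (σ : Equiv.Perm (Fin m)), (MvPolynomial.aeval (fun o : Option (Fin m) =>
      o.elim (X : ℝ[X]) fun l => C (((σ l : Fin m) : ℕ) : ℝ)) H).coeff d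
      = ∑ s ∈ H.support, (if d = s none then H.coeff s else 0)
        * ∏ l, (((σ l : Fin m) : ℕ) : ℝ) ^ s (some l) := by
    intro σ
    conv_lhs => rw [H.as_sum]
    rw [map_sum, finsetSum_coeff]
    refine Finset.sum_congr rfl fun s _ => ?_
    rw [MvPolynomial.aeval_monomial, Finsupp.prod_fintype _ _ fun _ => pow_zero _,
      Fintype.prod_option]
    simp only [Option.elim_none, Option.elim_some, ← C_pow, ← map_prod]
    rw [← mul_assoc, coeff_mul_C, algebraMap_eq, coeff_C_mul, coeff_X_pow]
    simp
  rw [finsetSum_coeff]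
  simp only [coeff_smul, hmon, smul_eq_mul, Finset.mul_sum]
  rw [Finset.sum_comm]
  refine Finset.sum_eq_zero fun s hs => ?_
  by_cases hds : d = s none
  -- The signed sum of ∏ σ(l)^{s_l} is a determinant. Distinct exponents would sum to at least 0 + ⋯
  -- + (m - 1), beyond the total degree, so two columns agree.
  · have hdet : (Matrix.of fun r l : Fin m => ((r : ℕ) : ℝ) ^ s (some l)).det = 0 := by
      have hninj : ¬ Function.Injective fun l => s (some l) := by
        intro hinj
        have h1 := sum_range_le_sum_of_injective hinj
        have h2 := MvPolynomial.le_totalDegree hs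
        rw [Finsupp.sum_fintype _ _ fun _ => rfl, Fintype.sum_option] at h2
        omega
      obtain ⟨l, l', hll, hne⟩ := Function.not_injective_iff.mp hninj
      refine Matrix.det_zero_of_column_eq hne fun r => ?_
      simp only [Matrix.of_apply, hll]
    rw [Matrix.det_apply'] at hdet
    rw [← mul_zero (H.coeff s), ← hdet, Finset.mul_sum]
    refine Finset.sum_congr rfl fun σ _ => ?_
    rw [if_pos hds]
    simp only [Matrix.of_apply]
    ring
  · simp [hds]

/-- The polynomial `y ↦ ∑_t adj (Y_i (y + t - j))_{t, i}`. -/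
noncomputable def cofactorSum (Y : Fin m → ℝ[X]) (i : Fin m) : ℝ[X] :=
  ∑ σ : Equiv.Perm (Fin m), ((Equiv.Perm.sign σ : ℤ) : ℝ) •
    ∏ l ∈ Finset.univ.erase i,
      taylor ((((σ i : Fin m) : ℕ) : ℝ) - (((σ l : Fin m) : ℕ) : ℝ)) (Y l)

/-- Expanding the t-th cofactor keeps the permutations with σ i = t. Summing over t restores all
permutations, and hence the full antisymmetrization. -/
theorem cofactorSum_eval (Y : Fin m → ℝ[X]) (i : Fin m) (y : ℝ) :
    (cofactorSum Y i).eval y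
      = ∑ t : Fin m, (shiftMatrix Y (y + ((t : ℕ) + 1))).adjugate t i := by
  have h : ∀ t : Fin m, (shiftMatrix Y (y + ((t : ℕ) + 1))).adjugate t i
      = ∑ σ : Equiv.Perm (Fin m), if t = σ i then ((Equiv.Perm.sign σ : ℤ) : ℝ) *
        ∏ l ∈ Finset.univ.erase i,
          (Y l).eval (y + ((((σ i : Fin m) : ℕ) : ℝ) - (((σ l : Fin m) : ℕ) : ℝ))) else 0 := by
    intro t
    rw [Matrix.adjugate_apply, ← Matrix.det_transpose, Matrix.det_apply']
    refine Finset.sum_congr rfl fun σ _ => ?_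
    rw [← Finset.mul_prod_erase _ _ (Finset.mem_univ i), Matrix.transpose_apply,
      Matrix.updateRow_self]
    by_cases ht : t = σ i
    · rw [if_pos ht, ht, Pi.single_eq_same, one_mul]
      congr 1
      refine Finset.prod_congr rfl fun l hl => ?_
      rw [Matrix.transpose_apply, Matrix.updateRow_ne (Finset.ne_of_mem_erase hl), shiftMatrix,
        Matrix.of_apply]
      congr 1
      ring
    · rw [if_neg ht, Pi.single_eq_of_ne fun h => ht h.symm]
      ring
  simp only [h]
  rw [Finset.sum_comm]
  simp only [Finset.sum_ite_eq', Finset.mem_univ, if_true, cofactorSum, eval_finsetSum, eval_smul,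
    eval_prod, taylor_eval, smul_eq_mul]

theorem totalDegree_aeval_le {τ : Type*} {H : MvPolynomial τ ℝ} (hH : H.totalDegree ≤ 1)
    (P : ℝ[X]) : (aeval H P).totalDegree ≤ P.natDegree := by
  rw [aeval_eq_sum_range]
  refine MvPolynomial.totalDegree_finsetSum_le fun k hk => ?_
  refine (MvPolynomial.totalDegree_smul_le _ _).trans ((MvPolynomial.totalDegree_pow _ _).trans ?_)
  have := Finset.mem_range.mp hk
  calc k * H.totalDegree ≤ k * 1 := Nat.mul_le_mul le_rfl hH
    _ ≤ P.natDegree := by omega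

/-- M_i antisymmetrizes one polynomial in y and m node variables, of total degree at most Σ_{l ≠ i}
deg Y_l. The zero case is separate because `natDegree` of 0 is 0, for which the bound may fail. -/
theorem cofactorSum_natDegree (Y : Fin m → ℝ[X]) (i : Fin m) :
    cofactorSum Y i = 0 ∨ (cofactorSum Y i).natDegree + ∑ k ∈ Finset.range m, k
      ≤ ∑ l ∈ Finset.univ.erase i, (Y l).natDegree := by
  rw [or_iff_not_imp_left]
  intro hne
  by_contra hlt
  rw [not_le] at hlt
  set H : MvPolynomial (Option (Fin m)) ℝ := ∏ l ∈ Finset.univ.erase i,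
    aeval (MvPolynomial.X none + (MvPolynomial.X (some i) - MvPolynomial.X (some l))) (Y l) with hH
  have hdeg : H.totalDegree ≤ ∑ l ∈ Finset.univ.erase i, (Y l).natDegree := by
    refine (MvPolynomial.totalDegree_finsetProd _ _).trans (Finset.sum_le_sum fun l _ => ?_)
    refine totalDegree_aeval_le ?_ _
    refine (MvPolynomial.totalDegree_add _ _).trans (max_le ?_
      ((MvPolynomial.totalDegree_sub _ _).trans (max_le ?_ ?_))) <;>
    exact (MvPolynomial.totalDegree_X _).le
  have h0 := coeff_sum_sign_aeval_eq_zero H (lt_of_le_of_lt hdeg hlt)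
  have heq : (∑ σ : Equiv.Perm (Fin m), ((Equiv.Perm.sign σ : ℤ) : ℝ) •
      MvPolynomial.aeval (fun o : Option (Fin m) =>
        o.elim (X : ℝ[X]) fun l => C (((σ l : Fin m) : ℕ) : ℝ)) H) = cofactorSum Y i := by
    refine Finset.sum_congr rfl fun σ _ => ?_
    congr 1
    rw [hH, map_prod]
    refine Finset.prod_congr rfl fun l _ => ?_
    rw [← aeval_algHom_apply]
    simp only [map_add, map_sub, MvPolynomial.aeval_X, Option.elim_none, Option.elim_some]
    rw [taylor_apply, C_sub]
    rfl
  rw [heq] at h0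
  exact hne (leadingCoeff_eq_zero.mp h0)

theorem prod_natDegree_coeff {ι : Type*} (s : Finset ι) (f : ι → ℝ[X]) (d : ι → ℕ)
    (h : ∀ i ∈ s, (f i).natDegree ≤ d i) :
    (∏ i ∈ s, f i).natDegree ≤ ∑ i ∈ s, d i ∧
      (∏ i ∈ s, f i).coeff (∑ i ∈ s, d i) = ∏ i ∈ s, (f i).coeff (d i) := by
  classical
  induction s using Finset.induction_on with
  | empty => simp
  | insert i s hi ih =>
    obtain ⟨h1, h2⟩ := ih fun j hj => h j (Finset.mem_insert_of_mem hj)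
    have h3 := h i (Finset.mem_insert_self i s)
    rw [Finset.prod_insert hi, Finset.sum_insert hi, Finset.prod_insert hi]
    exact ⟨natDegree_mul_le.trans (Nat.add_le_add h3 h1),
      by rw [coeff_mul_add_eq_of_natDegree_le h3 h1, h2]⟩

theorem det_coeff_sum (A : Matrix (Fin m) (Fin m) ℝ[X]) (d : Fin m → ℕ)
    (h : ∀ i j, (A i j).natDegree ≤ d i) :
    A.det.natDegree ≤ ∑ i, d i ∧
      A.det.coeff (∑ i, d i) = (Matrix.of fun i j => (A i j).coeff (d i)).det := by
  have hp := fun σ : Equiv.Perm (Fin m) =>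
    prod_natDegree_coeff Finset.univ (fun i => A i (σ i)) d fun i _ => h i (σ i)
  rw [← Matrix.det_transpose, Matrix.det_apply, ← Matrix.det_transpose (Matrix.of _),
    Matrix.det_apply]
  simp only [Matrix.transpose_apply]
  constructor
  · refine natDegree_sum_le_of_forall_le _ _ fun σ _ => ?_
    exact (natDegree_smul_le _ _).trans (hp σ).1
  · rw [finsetSum_coeff]
    refine Finset.sum_congr rfl fun σ _ => ?_
    rw [coeff_smul, (hp σ).2]
    rfl

theorem taylor_natCast_charlierInt (a : ℝ) (j N : ℕ) (hN : j < N) (k : ℤ) :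
    taylor (j : ℝ) (charlierInt a k)
      = ∑ i ∈ Finset.range N, (j.choose i : ℝ) • charlierInt a (k - i) := by
  have hone : ∀ k : ℤ, taylor 1 (charlierInt a k) = charlierInt a k + charlierInt a (k - 1) := by
    intro k
    have h := congrArg (taylor 1) (backwardDiff_charlierInt_add a (k - 1))
    rw [sub_add_cancel, map_add, backwardDiff_apply, backwardDiff_apply, map_sub, map_sub,
      taylor_taylor, taylor_taylor, add_neg_cancel, taylor_zero, taylor_zero] at h
    linear_combination h
  induction j generalizing N k with
  | zero =>
    obtain ⟨N, rfl⟩ : ∃ N', N = N' + 1 := ⟨N - 1, by omega⟩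
    rw [Finset.sum_range_succ']
    simp
  | succ j ih =>
    obtain ⟨N, rfl⟩ : ∃ N', N = N' + 1 := ⟨N - 1, by omega⟩
    have h1 := ih (N + 1) (by omega) k
    have h2 := ih N (by omega) (k - 1)
    rw [Finset.sum_range_succ'] at h1
    push_cast
    rw [← taylor_taylor, hone, map_add, h1, h2, Finset.sum_range_succ']
    simp only [Nat.choose_succ_succ, Nat.cast_add, add_smul, Finset.sum_add_distrib]
    have hk : ∀ i : ℕ, k - 1 - (i : ℤ) = k - ((i : ℤ) + 1) := fun i => by ring
    simp only [hk, Nat.choose_zero_right, Nat.cast_zero, Nat.cast_one]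
    abel

/-- The determinant `det (c_{g_i} (z + j))`, as a polynomial in `z`, has degree `∑ g_i - m (m - 1) / 2`. -/
theorem natDegree_det_taylor_charlier (a : ℝ) {g : Fin m → ℕ} (hg : Function.Injective g) :
    (Matrix.of fun i j : Fin m => taylor ((j : ℕ) : ℝ) (charlier a (g i))).det ≠ 0 ∧
    (Matrix.of fun i j : Fin m => taylor ((j : ℕ) : ℝ) (charlier a (g i))).det.natDegree
      + ∑ k ∈ Finset.range m, k = ∑ i, g i := by
  set B : Matrix (Fin m) (Fin m) ℝ[X] :=
    Matrix.of fun i k => charlierInt a ((g i : ℤ) - (k : ℕ)) with hB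
  -- Since c_k(x + j) = Σ_i (j choose i) c_{k-i}(x), a unitriangular factor trades shifts of the
  -- variable for shifts of the index.
  have hfact : (Matrix.of fun i j : Fin m => taylor ((j : ℕ) : ℝ) (charlier a (g i)))
      = B * Matrix.of fun k j : Fin m => (C (((j : ℕ).choose (k : ℕ) : ℕ) : ℝ) : ℝ[X]) := by
    ext1 i j
    rw [Matrix.mul_apply, Matrix.of_apply, ← charlierInt_natCast,
      taylor_natCast_charlierInt a j m j.2, Finset.sum_range]
    refine Finset.sum_congr rfl fun k _ => ?_
    rw [hB, Matrix.of_apply, Matrix.of_apply, smul_eq_C_mul, mul_comm]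
  have hdet : (Matrix.of fun i j : Fin m => taylor ((j : ℕ) : ℝ) (charlier a (g i))).det
      = B.det := by
    have hU : (Matrix.of fun k j : Fin m =>
        (C (((j : ℕ).choose (k : ℕ) : ℕ) : ℝ) : ℝ[X])).det = 1 := by
      rw [Matrix.det_of_isUpperTriangular]
      · simp
      · intro k j hjk
        have : (j : ℕ) < (k : ℕ) := hjk
        rw [Matrix.of_apply, Nat.choose_eq_zero_of_lt this]
        simp
    rw [hfact, Matrix.det_mul, hU, mul_one]
  rw [hdet]
  -- Weighting column k by x^k bounds all degrees in row i by g_i. The coefficients of x^{g_i} then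
  -- form a Vandermonde-type determinant in the distinct g_i.
  have hX : (Matrix.of fun i k : Fin m => (X : ℝ[X]) ^ (k : ℕ) * B i k).det
      = X ^ (∑ k ∈ Finset.range m, k) * B.det := by
    rw [Matrix.det_mul_row, Finset.prod_pow_eq_pow_sum, Finset.sum_range]
  have hcoeff : ∀ i k : Fin m, ((X : ℝ[X]) ^ (k : ℕ) * B i k).natDegree ≤ g i ∧
      ((X : ℝ[X]) ^ (k : ℕ) * B i k).coeff (g i)
        = (1 / ((g i).factorial : ℝ)) * (descPochhammer ℝ k).eval (g i : ℝ) := by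
    intro i k
    rw [hB, Matrix.of_apply]
    by_cases hk : (k : ℕ) ≤ g i
    · rw [charlierInt_sub_of_le a hk]
      constructor
      · refine natDegree_mul_le.trans ?_
        have := (natDegree_charlier_le a (g i - k)).1
        rw [natDegree_X_pow]
        omega
      · rw [coeff_X_pow_mul', if_pos hk, (natDegree_charlier_le a (g i - k)).2,
          descPochhammer_eval_eq_descFactorial, ← Nat.factorial_mul_descFactorial hk]
        push_cast
        have h1 : ((g i - k).factorial : ℝ) ≠ 0 := by positivity
        have h2 : ((g i).descFactorial k : ℝ) ≠ 0 := by
          exact_mod_cast (Nat.pos_iff_ne_zero.mp (Nat.descFactorial_pos.mpr hk))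
        field_simp
    · rw [charlierInt_of_neg a (by omega), mul_zero, natDegree_zero, coeff_zero,
        descPochhammer_eval_eq_descFactorial, Nat.descFactorial_of_lt (by omega)]
      simp
  obtain ⟨h1, h2⟩ := det_coeff_sum (Matrix.of fun i k : Fin m => (X : ℝ[X]) ^ (k : ℕ) * B i k) g
    fun i k => (hcoeff i k).1
  have hne : (Matrix.of fun i k : Fin m => (X : ℝ[X]) ^ (k : ℕ) * B i k).det.coeff (∑ i, g i)
      ≠ 0 := by
    rw [h2]
    have hM : (Matrix.of fun i k : Fin m =>
        ((Matrix.of fun i k : Fin m => (X : ℝ[X]) ^ (k : ℕ) * B i k) i k).coeff (g i))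
        = Matrix.of fun i k : Fin m => (1 / ((g i).factorial : ℝ)) *
          (Matrix.of fun i k : Fin m => (descPochhammer ℝ k).eval (g i : ℝ)) i k := by
      ext1 i k
      exact (hcoeff i k).2
    rw [hM, Matrix.det_mul_column]
    refine mul_ne_zero (Finset.prod_ne_zero_iff.mpr fun i _ => by positivity) ?_
    rw [← Matrix.det_eval_matrixOfPolynomials_eq_det_vandermonde (fun i => (g i : ℝ))
      (fun k => descPochhammer ℝ k) (fun k => descPochhammer_natDegree ℝ k)
      fun k => monic_descPochhammer ℝ k]
    exact Matrix.det_vandermonde_ne_zero_iff.mpr fun i j h => hg (Nat.cast_injective (R := ℝ) h)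
  rw [hX] at h1 hne
  have hB0 : B.det ≠ 0 := by
    intro h
    rw [h, mul_zero, coeff_zero] at hne
    exact hne rfl
  refine ⟨hB0, ?_⟩
  have h3 := le_natDegree_of_ne_zero hne
  rw [natDegree_X_pow_mul _ hB0] at h1 h3
  omega

end Degrees

/-! ### Antidifferences and assembly of the operator. -/

theorem exists_forwardDiff_eq (d : ℕ) (P : ℝ[X]) (hP : P.natDegree ≤ d) :
    ∃ Q : ℝ[X], Q.natDegree ≤ d + 1 ∧ taylor 1 Q - Q = P ∧
      ((d : ℝ) + 1) * Q.coeff (d + 1) = P.coeff d := by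
  induction d generalizing P with
  | zero =>
    refine ⟨C (P.coeff 0) * X, (natDegree_C_mul_le _ _).trans natDegree_X_le, ?_, ?_⟩
    · conv_rhs => rw [eq_C_of_natDegree_le_zero hP]
      rw [taylor_mul, taylor_C, taylor_X, C_1]
      ring
    · simp
  | succ d ih =>
    set Q₀ : ℝ[X] := C (P.coeff (d + 1) / ((d : ℝ) + 2)) * X ^ (d + 2) with hQ₀
    have hQ₀deg : Q₀.natDegree ≤ d + 1 + 1 := natDegree_C_mul_X_pow_le _ _
    obtain ⟨h1, h2⟩ := forwardDiff_natDegree_coeff hQ₀deg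
    have hc : Q₀.coeff (d + 1 + 1) = P.coeff (d + 1) / ((d : ℝ) + 2) := by
      rw [hQ₀, coeff_C_mul, coeff_X_pow]
      simp
    have hne : (d : ℝ) + 2 ≠ 0 := by positivity
    have h3 : (P - (taylor 1 Q₀ - Q₀)).natDegree ≤ d := by
      rw [natDegree_le_iff_coeff_eq_zero]
      intro k hk
      rw [coeff_sub]
      rcases (Nat.succ_le_of_lt hk).eq_or_lt with rfl | hlt
      · rw [Nat.succ_eq_add_one, h2, hc]
        push_cast
        field_simp
        ring
      · rw [coeff_eq_zero_of_natDegree_lt (lt_of_le_of_lt hP hlt),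
          coeff_eq_zero_of_natDegree_lt (lt_of_le_of_lt h1 hlt), sub_zero]
    obtain ⟨Q, hQ1, hQ2, _⟩ := ih _ h3
    refine ⟨Q + Q₀, ?_, ?_, ?_⟩
    · exact natDegree_add_le_of_degree_le (hQ1.trans (by omega)) hQ₀deg
    · rw [map_add]
      linear_combination hQ2
    · rw [coeff_add, hc, coeff_eq_zero_of_natDegree_lt (show Q.natDegree < d + 1 + 1 by omega)]
      push_cast
      field_simp
      ring

section Assembly

variable {m : ℕ} {a : ℝ}

/-- The polynomial `x ↦ c_g^{-a} (-x - 1)`. -/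
noncomputable def dualCharlier (a : ℝ) (k : ℕ) : ℝ[X] := (charlier (-a) k).comp (-X - 1)

theorem dualCharlier_eval (a : ℝ) (k : ℕ) (x : ℝ) :
    (dualCharlier a k).eval x = (charlier (-a) k).eval (-x - 1) := by
  simp [dualCharlier, eval_comp]

theorem dualCharlier_natDegree_le (a : ℝ) (k : ℕ) : (dualCharlier a k).natDegree ≤ k := by
  refine natDegree_comp_le.trans ?_
  have h : (-X - 1 : ℝ[X]).natDegree ≤ 1 := by
    refine (natDegree_sub_le _ _).trans ?_
    simp
  calc _ ≤ k * 1 := Nat.mul_le_mul (natDegree_charlier_le _ _).1 h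
    _ = k := mul_one k

theorem exists_casorati_antidifference (a : ℝ) {g : Fin m → ℕ} (hg : Function.Injective g) :
    ∃ (e : ℕ) (P : ℝ[X]), e + ∑ k ∈ Finset.range m, k = ∑ i, g i ∧ P.natDegree ≤ e + 1 ∧
      P.coeff (e + 1) ≠ 0 ∧
      ∀ x, P.eval x - P.eval (x - 1) = (shiftMatrix (fun i => dualCharlier a (g i)) x).det := by
  obtain ⟨h0, hdeg⟩ := natDegree_det_taylor_charlier (-a) hg
  set T : Matrix (Fin m) (Fin m) ℝ[X] :=
    Matrix.of fun i j : Fin m => taylor ((j : ℕ) : ℝ) (charlier (-a) (g i)) with hT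
  set W : ℝ[X] := T.det.comp (-X) with hW
  have hWdeg : W.natDegree = T.det.natDegree := by
    rw [hW, natDegree_comp, natDegree_neg, natDegree_X, mul_one]
  have hW0 : W ≠ 0 := by
    intro h
    rw [hW] at h
    apply h0
    have h' := congrArg (fun p => p.comp (-X)) h
    simpa [comp_assoc] using h'
  have hWeval : ∀ x, W.eval x = (shiftMatrix (fun i => dualCharlier a (g i)) x).det := by
    intro x
    rw [hW, eval_comp, eval_neg, eval_X, ← coe_evalRingHom, RingHom.map_det]
    congr 1
    ext1 i j
    rw [RingHom.mapMatrix_apply, Matrix.map_apply, hT, Matrix.of_apply, coe_evalRingHom,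
      taylor_eval, shiftMatrix, Matrix.of_apply, dualCharlier_eval]
    congr 1
    ring
  obtain ⟨Q, hQ1, hQ2, hQ3⟩ := exists_forwardDiff_eq W.natDegree W le_rfl
  have ht := HasSymbol.natDegree_coeff_taylor hQ1 1
  -- The translation by 1 turns a forward antidifference into a backward one.
  refine ⟨W.natDegree, taylor 1 Q, by rw [hWdeg, hdeg], ht.1, ?_, fun x => ?_⟩
  · rw [ht.2]
    intro h
    rw [h, mul_zero] at hQ3
    exact hW0 (leadingCoeff_eq_zero.mp hQ3.symm)
  · rw [← hWeval, ← hQ2, taylor_eval, taylor_eval, eval_sub, taylor_eval]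
    congr 2
    ring

/-- The i-th correction has shifts from -(g_i + 1 + (e - g_i)) = -(e + 1) to e. It misses the right
end, and at the left end its coefficient has degree at most e. So the constant at shift e + 1 and
the x^(e+1)-coefficient at shift -(e + 1) come from P(N) alone. -/
theorem krallOp_hasSymbol (a : ℝ) {g : Fin m → ℕ} {e : ℕ} {P : ℝ[X]}
    (he : e + ∑ k ∈ Finset.range m, k = ∑ i, g i) (hP : P.natDegree ≤ e + 1) :
    HasSymbol (krallOp a P (cofactorSum fun i => dualCharlier a (g i))
        fun i => dualCharlier a (g i)) (-((e : ℤ) + 1)) ((e : ℤ) + 1) (e + 1)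
      ((-1) ^ (e + 1) * P.coeff (e + 1)) ((-a) ^ (e + 1) * P.coeff (e + 1)) := by
  set Y : Fin m → ℝ[X] := fun i => dualCharlier a (g i) with hY
  have h1 := HasSymbol.one.aeval_charlierOp_mul a hP
  rw [mul_one, mul_one, mul_one, zero_sub, zero_add, zero_add] at h1
  push_cast at h1
  have h2 : ∀ i ∈ (Finset.univ : Finset (Fin m)),
      HasSymbol (aeval (charlierOp a) (cofactorSum Y i) *
        (backwardDiff * aeval (charlierOp a) (Y i)))
        (-((e : ℤ) + 1)) ((e : ℤ) + 1) (e + 1) 0 0 := by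
    intro i _
    rcases cofactorSum_natDegree Y i with h0 | hdeg
    · rw [h0, map_zero, zero_mul]
      exact HasSymbol.zero _ _ _
    · have hsum : ∑ l ∈ Finset.univ.erase i, (Y l).natDegree ≤ ∑ l ∈ Finset.univ.erase i, g l :=
        Finset.sum_le_sum fun l _ => dualCharlier_natDegree_le a (g l)
      have hsplit := Finset.add_sum_erase Finset.univ g (Finset.mem_univ i)
      have hM : (cofactorSum Y i).natDegree ≤ e - g i := by omega
      have hge : g i ≤ e := by omega
      have h3 := ((HasSymbol.one.aeval_charlierOp_mul a
        (dualCharlier_natDegree_le a (g i))).backwardDiff_mul).aeval_charlierOp_mul a hM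
      rw [mul_one] at h3
      have h4 := (h3.widen_right (r' := (e : ℤ) + 1) (by omega)).mono_degree (d' := e + 1)
        (by omega)
      convert h4 using 1
      omega
  have h3 := h1.add (HasSymbol.sum Finset.univ h2)
  rw [add_zero, add_zero] at h3
  exact h3

/-- F and the κ_i partition {0, …, L - 1}, so |F| + m = L, and Σ f + Σ κ_i = L(L - 1)/2 with Σ κ_i =
m(L - 1) - Σ g_i. -/
theorem krallOrder_eq {F : Finset ℕ} {L : ℕ} {κ g : Fin m → ℕ} (hκ : ∀ i, κ i + g i + 1 = L)
    (hinj : Function.Injective κ) (hF : ∀ x, x ∈ F ↔ x < L ∧ ∀ i, κ i ≠ x) {e : ℕ}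
    (he : e + ∑ k ∈ Finset.range m, k = ∑ i, g i) : krallOrder F = (e : ℤ) + 1 := by
  have hdisj : Disjoint F (Finset.univ.image κ) := by
    rw [Finset.disjoint_left]
    intro x hx hx'
    obtain ⟨i, _, hi⟩ := Finset.mem_image.mp hx'
    exact ((hF x).mp hx).2 i hi
  have hunion : F ∪ Finset.univ.image κ = Finset.range L := by
    ext x
    simp only [Finset.mem_union, hF, Finset.mem_image, Finset.mem_univ, true_and, Finset.mem_range]
    constructor
    · rintro (h | ⟨i, rfl⟩)
      · exact h.1
      · have := hκ i
        omega
    · intro hx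
      by_cases h : ∃ i, κ i = x
      · exact Or.inr h
      · exact Or.inl ⟨hx, fun i hi => h ⟨i, hi⟩⟩
  have hcard : F.card + m = L := by
    have := Finset.card_union_of_disjoint hdisj
    rw [hunion, Finset.card_range, Finset.card_image_of_injective _ hinj, Finset.card_univ,
      Fintype.card_fin] at this
    exact this.symm
  have hsum : ∑ f ∈ F, f + ∑ i, κ i = ∑ k ∈ Finset.range L, k := by
    rw [← hunion, Finset.sum_union hdisj, Finset.sum_image fun x _ y _ h => hinj h]
  have hκg : ∑ i, κ i + ∑ i, g i + m = m * L := by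
    have : ∑ i : Fin m, (κ i + g i + 1) = ∑ _i : Fin m, L :=
      Finset.sum_congr rfl fun i _ => hκ i
    simpa [Finset.sum_add_distrib] using this
  have htri : ∀ N : ℕ, 2 * ((∑ k ∈ Finset.range N, k : ℕ) : ℤ) = (N : ℤ) * ((N : ℤ) - 1) := by
    intro N
    induction N with
    | zero => simp
    | succ N ih =>
      rw [Finset.sum_range_succ]
      push_cast at ih ⊢
      linarith
  have hdiv : (F.card : ℤ) * ((F.card : ℤ) - 1) / 2
      = ((∑ k ∈ Finset.range F.card, k : ℕ) : ℤ) := by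
    rw [← htri]
    exact Int.mul_ediv_cancel_left _ two_ne_zero
  have h1 := htri F.card
  have h2 := htri m
  have h3 := htri L
  rw [← Nat.cast_inj (R := ℤ)] at hsum hκg he
  rw [krallOrder, hdiv, ← Nat.cast_sum]
  subst hcard
  push_cast at *
  nlinarith

theorem exists_differenceOperator (ha : a ≠ 0) {F : Finset ℕ} {L : ℕ} {κ g : Fin m → ℕ}
    (hκ : ∀ i, κ i + g i + 1 = L)
    (hinj : Function.Injective κ) (hF : ∀ x, x ∈ F ↔ x < L ∧ ∀ i, κ i ≠ x) {q : ℕ → ℝ[X]}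
    (hq : IsOrthogonalSequence (charlierChristoffel a F) q) :
    ∃ D : ℝ[X] →ₗ[ℝ] ℝ[X], IsDifferenceOperator D (-krallOrder F) (krallOrder F) ∧
      ∃ eigenvalue : ℕ → ℝ, ∀ n, D (q n) = C (eigenvalue n) * q n := by
  have hg : Function.Injective g := by
    intro i j hij
    apply hinj
    have h1 := hκ i
    have h2 := hκ j
    omega
  obtain ⟨e, P, he, hP, hP0, hPdiff⟩ := exists_casorati_antidifference a hg
  rw [krallOrder_eq hκ hinj hF he]
  have hsym := krallOp_hasSymbol a he hP
  -- The operator is conjugated by translation by L, because q_n is a combination of Charlier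
  -- polynomials at x - L.
  refine ⟨_, hsym.isDifferenceOperator (by omega)
    (mul_ne_zero (pow_ne_zero _ (by norm_num)) hP0)
    (mul_ne_zero (pow_ne_zero _ (neg_ne_zero.mpr ha)) hP0) L, fun n => P.eval (n : ℝ),
    fun n => ?_⟩
  obtain ⟨c, γ, hγ, hqn⟩ := hq.eq_smul_charlierComb ha hκ hinj hF n
  have hmain := krallOp_charlierComb a (Y := fun i => dualCharlier a (g i))
    (cofactorSum_eval _) hPdiff (n := n) (γ := γ) fun i => by
      simp only [dualCharlier_eval]
      exact hγ i
  rw [hqn, LinearMap.comp_apply, LinearMap.comp_apply, map_smul (taylor (L : ℝ)), taylor_taylor,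
    add_neg_cancel, taylor_zero, map_smul, hmain, map_smul, map_smul, smul_comm, smul_eq_C_mul]

end Assembly

/-! ### The gaps of F in terms of I(F). -/

theorem mem_involution_iff {F : Finset ℕ} (hne : F.Nonempty) (x : ℕ) :
    x ∈ involution F ↔ x ≤ F.sup id ∧ F.sup id - x ∉ F := by
  have hmax : F.sup id ∈ F := by
    obtain ⟨f, hf, hfe⟩ := Finset.exists_mem_eq_sup F hne id
    rw [hfe]
    exact hf
  have hle : ∀ f ∈ F, f ≤ F.sup id := fun f hf => Finset.le_sup (f := id) hf
  rw [involution, Finset.mem_sdiff, Finset.mem_Icc, Finset.mem_image]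
  constructor
  · rintro ⟨⟨h1, h2⟩, h3⟩
    exact ⟨h2, fun h => h3 ⟨_, h, by omega⟩⟩
  · rintro ⟨h1, h2⟩
    -- The lower bound 1 in I(F) is automatic, since max F lies in F.
    have hx : x ≠ 0 := by
      rintro rfl
      exact h2 (by simpa using hmax)
    refine ⟨⟨by omega, h1⟩, ?_⟩
    rintro ⟨f, hf, rfl⟩
    have := hle f hf
    exact h2 (by rwa [show F.sup id - (F.sup id - f) = f by omega])

/-- The complement of `F` in an initial segment is the reflection of `involution F`. -/
theorem exists_complement (F : Finset ℕ) :
    ∃ (L : ℕ) (κ : Fin (involution F).card → ℕ),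
      (∀ i, κ i + (involution F).orderEmbOfFin rfl i + 1 = L) ∧ Function.Injective κ ∧
      ∀ x, x ∈ F ↔ x < L ∧ ∀ i, κ i ≠ x := by
  rcases F.eq_empty_or_nonempty with rfl | hne
  · have h0 : (involution ∅).card = 0 := by simp [involution]
    -- Here L must be 0 rather than max F + 1 = 1: the point 0 would otherwise be a gap, and I(∅) is
    -- empty.
    refine ⟨0, fun _ => 0, fun i => ?_, fun i => ?_, by simp⟩ <;>
    exact absurd i.2 (by omega)
  · have hmem := mem_involution_iff hne
    have hle : ∀ i, (involution F).orderEmbOfFin rfl i ≤ F.sup id := fun i =>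
      ((hmem _).mp (Finset.orderEmbOfFin_mem _ rfl i)).1
    refine ⟨F.sup id + 1, fun i => F.sup id - (involution F).orderEmbOfFin rfl i, fun i => ?_,
      fun i j hij => ?_, fun x => ⟨fun hx => ⟨?_, fun i hi => ?_⟩, fun ⟨hx, hκ⟩ => ?_⟩⟩
    · have := hle i
      dsimp only
      omega
    · have h1 := hle i
      have h2 := hle j
      have hij' : F.sup id - (involution F).orderEmbOfFin rfl i
        = F.sup id - (involution F).orderEmbOfFin rfl j := hij
      exact ((involution F).orderEmbOfFin rfl).injective (by omega)
    · exact Nat.lt_succ_of_le (Finset.le_sup (f := id) hx)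
    · have h2 := ((hmem _).mp (Finset.orderEmbOfFin_mem _ rfl i)).2
      have hi' : F.sup id - (involution F).orderEmbOfFin rfl i = x := hi
      rw [hi'] at h2
      exact h2 hx
    · by_contra hxF
      have hx' : F.sup id - x ∈ involution F := by
        rw [hmem]
        exact ⟨Nat.sub_le _ _, by rwa [show F.sup id - (F.sup id - x) = x by omega]⟩
      have hrange : F.sup id - x ∈ Set.range ((involution F).orderEmbOfFin rfl) := by
        rw [Finset.range_orderEmbOfFin]
        exact hx'
      obtain ⟨i, hi⟩ := hrange
      have h3 := hκ i
      dsimp only at h3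
      omega

theorem casorati_eq_det (a : ℝ) (G : Finset ℕ) (n : ℕ) :
    casorati a G n = (casoratiMatrix a (fun i => G.orderEmbOfFin rfl i) n).det := by
  rw [casorati, casoratiMatrix]
  congr 1
  ext1 l j
  rw [Matrix.of_apply, Matrix.of_apply]
  congr 1
  ring

end CharlierKrall

theorem corollary5p2 (a : ℝ) (ha : a ≠ 0) (F : Finset ℕ) (hF : ∀ f ∈ F, 0 < f) :
    ((∀ n : ℕ, CharlierKrall.casorati a (CharlierKrall.involution F) n ≠ 0) →
      ∃ q : ℕ → Polynomial ℝ,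
        CharlierKrall.IsOrthogonalSequence (CharlierKrall.charlierChristoffel a F) q) ∧
    (∀ q : ℕ → Polynomial ℝ,
      CharlierKrall.IsOrthogonalSequence (CharlierKrall.charlierChristoffel a F) q →
      ∃ D : Polynomial ℝ →ₗ[ℝ] Polynomial ℝ,
        CharlierKrall.IsDifferenceOperator D
          (-CharlierKrall.krallOrder F) (CharlierKrall.krallOrder F) ∧
        ∃ eigenvalue : ℕ → ℝ,
          ∀ n : ℕ, D (q n) = Polynomial.C (eigenvalue n) * q n) := by
  obtain ⟨L, κ, hκ, hinj, hmem⟩ := CharlierKrall.exists_complement F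
  refine ⟨fun h => ?_, fun q hq => CharlierKrall.exists_differenceOperator ha hκ hinj hmem hq⟩
  refine CharlierKrall.exists_isOrthogonalSequence ha hκ hinj hmem fun n => ?_
  rw [← CharlierKrall.casorati_eq_det]
  exact h n
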